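/- Let $\Gamma\subset\mathbb R^3$ be a closed (compact, boundaryless, embedded) $C^2$ surface with a continuous unit normal field $\mathbf n$, let $0<\alpha<1$ and $\kappa\in\mathbb R$, and let $G^\kappa(\mathbf x,\mathbf y)=\dfrac{e^{i\kappa|\mathbf x-\mathbf y|}}{4\pi|\mathbf x-\mathbf y|}$. Denote by $\mathrm{Grad}$ the surface gradient and by $\mathrm{Div}$ the (weak) surface divergence on $\Gamma$, characterized by $\int_\Gamma\varphi\,\mathrm{Div}\,\mathbf F\,ds=-\int_\Gamma\mathrm{Grad}\,\varphi\cdot\mathbf F\,ds$ for all $\varphi\in C^1(\Gamma)$, and let $T_d^{0,\alpha}(\Gamma)$ be the space of $\alpha$-Hölder continuous complex tangential fields $\mathbf F$ on $\Gamma$ with $\mathrm{Div}\,\mathbf F\in C^{0,\alpha}(\Gamma)$. Let $\mathbf J$ be a complex tangential field on $\Gamma$ with $\mathbf n\times\mathbf J\in T_d^{0,\alpha}(\Gamma)$. Then for every $\mathbf x\in\Gamma$ $$ \begin{aligned} \mathbf n(\mathbf x)\cdot\nabla_{\mathbf x}\times\int_\Gamma G^\kappa(\mathbf x,\mathbf y)\mathbf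 J(\mathbf y)\,ds_{\mathbf y} ={}&-\int_\Gamma G^\kappa(\mathbf x,\mathbf y)\,\mathrm{Grad}_{\mathbf y}\big(\mathbf n(\mathbf x)\cdot\mathbf n(\mathbf y)\big)\cdot\big(\mathbf n(\mathbf y)\times\mathbf J(\mathbf y)\big)\,ds_{\mathbf y}\\ &-\int_\Gamma G^\kappa(\mathbf x,\mathbf y)\,\big(\mathbf n(\mathbf x)\cdot\mathbf n(\mathbf y)\big)\,\mathrm{Div}_{\mathbf y}\big(\mathbf n(\mathbf y)\times\mathbf J(\mathbf y)\big)\,ds_{\mathbf y}\\ &-\mathbf n(\mathbf x)\cdot\int_\Gamma\frac{\partial G^\kappa(\mathbf x,\mathbf y)}{\partial\mathbf n(\mathbf y)}\,\mathbf n(\mathbf y)\times\mathbf J(\mathbf y)\,ds_{\mathbf y}. \end{aligned} $$ Here the left-hand side exists, with this value, both as the Cauchy principal value $\lim_{\varepsilon\to0+}\int_{\Gamma\setminus B(\mathbf x,\varepsilon)}\mathbf n(\mathbf x)\cdot\nabla_{\mathbf x}\times\big(G^\kappa(\mathbf x,\mathbf y)\mathbf J(\mathbf y)\big)ds_{\mathbf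 y}$ and as the boundary value $\lim_{h\to0,\,h\ne0}\mathbf n(\mathbf x)\cdot\big(\nabla\times\int_\Gamma G^\kappa(\cdot,\mathbf y)\mathbf J(\mathbf y)ds_{\mathbf y}\big)(\mathbf x+h\mathbf n(\mathbf x))$ from either side of $\Gamma$. The three integrals on the right are weakly singular: they converge absolutely, and there is a constant $C$ (independent of $\mathbf x,\mathbf y$) such that the norms of the three integrands are at most $C/|\mathbf x-\mathbf y|$ for all distinct $\mathbf x,\mathbf y\in\Gamma$. -/

import Mathlib

open MeasureTheory Filter Topology
open scoped Matrix NNReal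

noncomputable section

/-- Euclidean space `ℝ³`. -/
abbrev E3 : Type := EuclideanSpace ℝ (Fin 3)

/-- Complex vectors `ℂ³`, the values of the (complex) vector fields. The bilinear products
`⬝ᵥ` and `⨯₃` are the dot and cross products. -/
abbrev C3 : Type := Fin 3 → ℂ

/-- A real vector regarded as a complex one. -/
def toC3 (v : E3) : C3 := fun i => ((v i : ℝ) : ℂ)

/-- `Γ` is a closed `C²` surface in `ℝ³`: a compact set which near each of its points is the zero
set of a `C²` function without critical points. (So `Γ` has no boundary; it need not be
connected.) -/
structure IsClosedC2Surface (Γ : Set E3) : Prop where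
  isCompact : IsCompact Γ
  locally_level_set : ∀ x ∈ Γ, ∃ U : Set E3, IsOpen U ∧ x ∈ U ∧ ∃ ρ : E3 → ℝ,
    ContDiffOn ℝ 2 ρ U ∧ (∀ y ∈ U, fderiv ℝ ρ y ≠ 0) ∧ Γ ∩ U = {y ∈ U | ρ y = 0}

/-- `n` is a (continuous) field of unit normal vectors on `Γ`. -/
structure IsUnitNormalField (Γ : Set E3) (n : E3 → E3) : Prop where
  continuousOn : ContinuousOn n Γ
  norm_eq_one : ∀ y ∈ Γ, ‖n y‖ = 1
  normal : ∀ y ∈ Γ, ∀ v ∈ tangentConeAt ℝ Γ y, inner ℝ (n y) v = 0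

/-- The surface measure `ds` of `Γ`: two-dimensional Hausdorff measure, normalized so that it is
the usual area, restricted to `Γ`. -/
def surfaceMeasure (Γ : Set E3) : Measure E3 :=
  (Measure.euclideanHausdorffMeasure 2 : Measure E3).restrict Γ

/-- The Helmholtz Green's function `G^κ(x, y) = exp (i κ |x - y|) / (4 π |x - y|)`. -/
def green (κ : ℝ) (x y : E3) : ℂ :=
  Complex.exp (Complex.I * (κ : ℂ) * (dist x y : ℂ)) / (4 * (Real.pi : ℂ) * (dist x y : ℂ))

/-- The normal derivative `∂G^κ(x, y) / ∂n(y)`. -/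
def greenNormalDeriv (κ : ℝ) (n : E3 → E3) (x y : E3) : ℂ :=
  fderiv ℝ (fun z => green κ x z) y (n y)

/-- The partial derivative `∂_i A_j (x)` of a vector field. -/
def partialD (A : E3 → C3) (x : E3) (i j : Fin 3) : ℂ :=
  fderiv ℝ A x (EuclideanSpace.single i 1) j

/-- The curl `∇ × A` of a vector field. -/
def curl (A : E3 → C3) (x : E3) : C3 :=
  ![partialD A x 1 2 - partialD A x 2 1,
    partialD A x 2 0 - partialD A x 0 2,
    partialD A x 0 1 - partialD A x 1 0]

/-- The vector single layer potential `∫_Γ G^κ(z, y) J(y) ds_y`. -/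
def singleLayer (Γ : Set E3) (κ : ℝ) (J : E3 → C3) (z : E3) : C3 :=
  ∫ y, green κ z y • J y ∂(surfaceMeasure Γ)

/-- Orthogonal projection onto the tangent plane at `y` (the plane orthogonal to the unit vector
`n y`). -/
def tangentProj (n : E3 → E3) (y v : E3) : E3 := v - (inner ℝ (n y) v : ℝ) • n y

/-- The surface gradient `Grad f (y)` of a scalar function on `Γ`: its `i`-th component is the
derivative of `f` along `Γ` in the direction of the tangential projection of the `i`-th basis
vector. In tangential directions the derivative of `f` within `Γ` is uniquely determined by
the values of `f` on `Γ`. -/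
def surfGrad (Γ : Set E3) (n : E3 → E3) (f : E3 → ℂ) (y : E3) : C3 :=
  fun i => fderivWithin ℝ f Γ y (tangentProj n y (EuclideanSpace.single i 1))

/-- `D` is a surface divergence of the tangential field `F` on `Γ`, in the usual (weak) sense for
fields that are merely integrable:
`∫_Γ φ D ds = - ∫_Γ Grad φ ⬝ F ds` for all `C¹` functions `φ` on `Γ`. (`C¹` functions on the
compact `C²` surface `Γ` are the restrictions of the `C¹` functions on `ℝ³`.) -/
structure HasSurfaceDiv (Γ : Set E3) (n : E3 → E3) (F : E3 → C3) (D : E3 → ℂ) : Prop where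
  integrable_field : Integrable F (surfaceMeasure Γ)
  integrable_div : Integrable D (surfaceMeasure Γ)
  integral_eq : ∀ φ : E3 → ℂ, ContDiff ℝ 1 φ →
    ∫ y, φ y * D y ∂(surfaceMeasure Γ) =
      -(∫ y, surfGrad Γ n φ y ⬝ᵥ F y ∂(surfaceMeasure Γ))

open Classical in
/-- The surface divergence `Div F`, for fields whose surface divergence is a continuous function
(which is then unique on `Γ`); zero for other fields. -/
def surfaceDiv (Γ : Set E3) (n : E3 → E3) (F : E3 → C3) : E3 → ℂ :=
  if h : ∃ D : E3 → ℂ, ContinuousOn D Γ ∧ HasSurfaceDiv Γ n F D then h.choose else 0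

/-- `F` is tangential on `Γ`. -/
def IsTangential (Γ : Set E3) (n : E3 → E3) (F : E3 → C3) : Prop :=
  ∀ y ∈ Γ, toC3 (n y) ⬝ᵥ F y = 0

/-- The Hölder space `C^{0,α}(Γ)` of functions with values in `V`. (On the compact `Γ` they are
automatically bounded.) -/
def HolderSpace {V : Type} [NormedAddCommGroup V] (Γ : Set E3) (α : ℝ≥0) : Set (E3 → V) :=
  {f | ∃ C : ℝ≥0, HolderOnWith C α f Γ}

/-- The space `T_d^{0,α}(Γ)` of the Hölder continuous tangential fields on `Γ` whose surface
divergence belongs to `C^{0,α}(Γ)`. -/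
def TdSpace (Γ : Set E3) (n : E3 → E3) (α : ℝ≥0) : Set (E3 → C3) :=
  {F | IsTangential Γ n F ∧ F ∈ HolderSpace Γ α ∧
    ∃ D : E3 → ℂ, D ∈ HolderSpace Γ α ∧ HasSurfaceDiv Γ n F D}

/-- The rotated field `n × J`. -/
def nCross (n : E3 → E3) (J : E3 → C3) (y : E3) : C3 := toC3 (n y) ⨯₃ J y

/-- The integrand `G^κ(x, y) Grad_y (n(x) ⬝ n(y)) ⬝ (n(y) × J(y))`. -/
def gradTerm (Γ : Set E3) (n : E3 → E3) (κ : ℝ) (J : E3 → C3) (x y : E3) : ℂ :=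
  green κ x y * (surfGrad Γ n (fun z => toC3 (n x) ⬝ᵥ toC3 (n z)) y ⬝ᵥ nCross n J y)

/-- The integrand `G^κ(x, y) (n(x) ⬝ n(y)) Div_y (n(y) × J(y))`. -/
def divTerm (Γ : Set E3) (n : E3 → E3) (κ : ℝ) (J : E3 → C3) (x y : E3) : ℂ :=
  green κ x y * (toC3 (n x) ⬝ᵥ toC3 (n y)) * surfaceDiv Γ n (nCross n J) y

/-- The integrand `(∂G^κ(x, y) / ∂n(y)) n(y) × J(y)`. -/
def doubleTerm (n : E3 → E3) (κ : ℝ) (J : E3 → C3) (x y : E3) : C3 :=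
  greenNormalDeriv κ n x y • nCross n J y

end

open scoped ENNReal RealInnerProductSpace

noncomputable section

/-! Put F = n × J. Since J is tangential, J = F × n, and the vector triple product gives, with z the
point where the curl is taken, ∇_z G × J = -(∂G/∂n(y)) F + (∇_y G · F) n(y), because ∇_z G = -∇_y G.
After the dot product with n(x), the first term is the double layer integrand. The second is (n(x) ·
n(y)) Grad_y G · F, and integration by parts on Γ turns it into -G Div((n(x) · n(y)) F), which the
product rule splits into the gradient and divergence terms. `dotProduct_curl_green_smul` is the
algebraic identity.

G is singular, so it is cut off: G(max(|z - y|, ε)) is constant inside the ball B(z, ε), so its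
gradient lives outside the ball and no boundary integral over the sphere appears. A C¹ smoothing of
the maximum makes it a legitimate test function, and `integral_compl_ball_greenRadialDeriv` removes
the smoothing.

Both readings of the left-hand side are then instances of `tendsto_integral_compl_ball_curl`, where
z → x nontangentially and ε → 0 together: z = x gives the principal value, while z = x + h n(x) with
ε = dist(z, Γ) gives the boundary value, since that ball misses Γ. There is no jump: n(y) · F(y) = 0
and n is Lipschitz, so n(x) · F(y) = O(|x - y|), which lowers the double layer to a 1/|x - y|
singularity even for z off Γ. Dominated convergence applies because 1/|x - y| is integrable on a C²
surface. -/

/-! ### Local parametrization, tangent cone and unit normal -/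

/-- The implicit function theorem, with the tangent plane as parameter domain. Because the
derivative at 0 is the inclusion, ψ almost preserves distances near 0; because images of
neighbourhoods are neighbourhoods in Γ, it misses no nearby point. Both facts enter the area
estimate. -/
theorem exists_param_of_level_set {E : Type*} [NormedAddCommGroup E] [NormedSpace ℝ E]
    [FiniteDimensional ℝ E] {Γ : Set E} {ρ : E → ℝ} {ρ' : E →L[ℝ] ℝ} {x : E}
    (h : HasStrictFDerivAt ρ ρ' x) (h0 : ρ' ≠ 0) (hx : x ∈ Γ)
    (hΓ : ∀ᶠ y in 𝓝 x, y ∈ Γ ↔ ρ y = 0) :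
    ∃ ψ : ρ'.ker → E, ψ 0 = x ∧ HasStrictFDerivAt ψ ρ'.ker.subtypeL 0 ∧
      (∀ᶠ u in 𝓝 0, ψ u ∈ Γ) ∧ ∀ s ∈ 𝓝 (0 : ρ'.ker), ψ '' s ∈ 𝓝[Γ] x := by
  have hcs : CompleteSpace E := FiniteDimensional.complete ℝ E
  have hr : ρ'.range = ⊤ := by
    apply LinearMap.range_eq_top.2
    exact LinearMap.surjective (f := (ρ' : E →ₗ[ℝ] ℝ)) (by
      intro hh; apply h0; ext v; exact congrArg (fun l : E →ₗ[ℝ] ℝ => l v) hh)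
  have hρx : ρ x = 0 := (hΓ.self_of_nhds).1 hx
  set ψ := h.implicitFunction ρ ρ' hr (ρ x) with hψ
  have hψ0 : ψ 0 = x := h.implicitFunction_apply_image hr
  have hd : HasStrictFDerivAt ψ ρ'.ker.subtypeL 0 := h.to_implicitFunction hr
  refine ⟨ψ, hψ0, hd, ?_, ?_⟩
  · have h1 : Tendsto (fun u : ρ'.ker => (ρ x, u)) (𝓝 0) (𝓝 (ρ x, 0)) :=
      (Continuous.prodMk_right (ρ x)).tendsto 0
    have h2 := h1.eventually (h.map_implicitFunction_eq hr)
    have h3 : Tendsto ψ (𝓝 0) (𝓝 x) := by simpa [hψ0] using hd.continuousAt.tendsto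
    filter_upwards [h2, h3.eventually hΓ] with u hu1 hu2
    exact hu2.2 (hu1.trans hρx)
  · intro s hs
    set Φ := h.implicitToOpenPartialHomeomorph ρ ρ' hr with hΦ
    have hc : Tendsto (fun y => (Φ y).2) (𝓝 x) (𝓝 0) := by
      have := Φ.continuousAt (h.mem_implicitToOpenPartialHomeomorph_source hr)
      have h4 := (continuous_snd.tendsto _).comp this
      simpa [hΦ, h.implicitToOpenPartialHomeomorph_self hr, Function.comp_def] using h4
    have h5 := h.eq_implicitFunction hr
    filter_upwards [nhdsWithin_le_nhds h5, nhdsWithin_le_nhds hΓ, nhdsWithin_le_nhds (hc hs),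
      self_mem_nhdsWithin] with y hy1 hy2 hy3 hy4
    refine ⟨_, hy3, ?_⟩
    rw [hψ, hρx, ← hy2.1 hy4]; exact hy1

/-- The curve t ↦ ψ(t v) stays in Γ for small t and has velocity v at 0. -/
theorem ker_subset_tangentConeAt_of_level_set {E : Type*} [NormedAddCommGroup E] [NormedSpace ℝ E]
    [FiniteDimensional ℝ E] {Γ : Set E} {ρ : E → ℝ} {ρ' : E →L[ℝ] ℝ} {x : E}
    (h : HasStrictFDerivAt ρ ρ' x) (h0 : ρ' ≠ 0) (hx : x ∈ Γ)
    (hΓ : ∀ᶠ y in 𝓝 x, y ∈ Γ ↔ ρ y = 0) {v : E} (hv : ρ' v = 0) :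
    v ∈ tangentConeAt ℝ Γ x := by
  obtain ⟨ψ, hψ0, hd, hΓψ, -⟩ := exists_param_of_level_set h h0 hx hΓ
  let u : ρ'.ker := ⟨v, hv⟩
  have hγ : HasDerivAt (fun t : ℝ => ψ (t • u)) v 0 := by
    have h1 : HasDerivAt (fun t : ℝ => t • u) u 0 := by
      simpa using (hasDerivAt_id (0 : ℝ)).smul_const u
    have h2 : HasFDerivAt ψ ρ'.ker.subtypeL ((0 : ℝ) • u) := by
      simpa using hd.hasFDerivAt
    simpa [u, Function.comp_def] using h2.comp_hasDerivAt 0 h1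
  have ht : Tendsto (fun t : ℝ => t • u) (𝓝 0) (𝓝 0) := by
    have hc : Continuous fun t : ℝ => t • u := by fun_prop
    simpa using hc.tendsto 0
  refine mem_tangentConeAt_of_seq (𝓝[≠] (0 : ℝ)) (fun t => t⁻¹)
    (fun t => ψ (t • u) - x) ?_ ?_ ?_
  · have h3 := hγ.continuousAt.tendsto
    simp only [zero_smul, hψ0] at h3
    have h4 : Tendsto (fun t : ℝ => ψ (t • u) - x) (𝓝 0) (𝓝 0) := by simpa using h3.sub_const x
    exact h4.mono_left nhdsWithin_le_nhds
  · filter_upwards [nhdsWithin_le_nhds (ht hΓψ)] with t ht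
    simpa using ht
  · have := hγ.tendsto_slope_zero
    simpa [hψ0] using this

theorem IsClosedC2Surface.exists_local_eq {Γ : Set E3} (hΓ : IsClosedC2Surface Γ) {x : E3}
    (hx : x ∈ Γ) : ∃ U : Set E3, IsOpen U ∧ x ∈ U ∧ ∃ ρ : E3 → ℝ,
      (∀ y ∈ U, ContDiffAt ℝ 2 ρ y) ∧ (∀ y ∈ U, fderiv ℝ ρ y ≠ 0) ∧
      (∀ y ∈ U, HasStrictFDerivAt ρ (fderiv ℝ ρ y) y) ∧
      ∀ y ∈ U, (y ∈ Γ ↔ ρ y = 0) := by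
  obtain ⟨U, hU, hxU, ρ, h1, h2, h3⟩ := hΓ.locally_level_set x hx
  refine ⟨U, hU, hxU, ρ, fun y hy => h1.contDiffAt (hU.mem_nhds hy), h2,
    fun y hy => (h1.contDiffAt (hU.mem_nhds hy)).hasStrictFDerivAt (by norm_num), fun y hy => ?_⟩
  constructor
  · intro h; exact ((Set.ext_iff.1 h3 y).1 ⟨h, hy⟩).2
  · intro h; exact ((Set.ext_iff.1 h3 y).2 ⟨hy, h⟩).1

/-- The gradient of a defining function is the multiple `ρ' n` of the unit normal `n`. -/
theorem IsUnitNormalField.apply_eq {Γ : Set E3} {n : E3 → E3} (hn : IsUnitNormalField Γ n)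
    {ρ : E3 → ℝ} {ρ' : E3 →L[ℝ] ℝ} {x : E3}
    (h : HasStrictFDerivAt ρ ρ' x) (h0 : ρ' ≠ 0) (hx : x ∈ Γ)
    (hΓ : ∀ᶠ y in 𝓝 x, y ∈ Γ ↔ ρ y = 0) (v : E3) :
    ρ' v = ρ' (n x) * ⟪n x, v⟫ := by
  obtain ⟨w, rfl⟩ := (InnerProductSpace.toDual ℝ E3).surjective ρ'
  have hw : w ≠ 0 := by rintro rfl; simp at h0
  have hw2 : ‖w‖ ^ 2 ≠ 0 := by positivity
  simp only [InnerProductSpace.toDual_apply_apply] at *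
  have hk : ∀ u : E3, ⟪w, u⟫ = 0 → ⟪n x, u⟫ = 0 := fun u hu =>
    hn.normal x hx u (ker_subset_tangentConeAt_of_level_set h h0 hx hΓ (by simpa using hu))
  have h1 := hk (n x - (⟪w, n x⟫ / ‖w‖ ^ 2) • w) (by
    rw [inner_sub_right, inner_smul_right, real_inner_self_eq_norm_sq]; field_simp; ring)
  have h2 := hk (v - (⟪w, v⟫ / ‖w‖ ^ 2) • w) (by
    rw [inner_sub_right, inner_smul_right, real_inner_self_eq_norm_sq]; field_simp; ring)
  rw [inner_sub_right, inner_smul_right, real_inner_self_eq_norm_sq, hn.norm_eq_one x hx,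
    real_inner_comm] at h1
  rw [inner_sub_right, inner_smul_right, real_inner_comm w (n x)] at h2
  field_simp at h1 h2
  have e1 : ⟪n x, v⟫ = ⟪w, v⟫ * ⟪w, n x⟫ / ‖w‖ ^ 2 := by field_simp; linarith
  rw [e1]; field_simp
  have e2 : ⟪w, n x⟫ ^ 2 = ‖w‖ ^ 2 := by rw [real_inner_comm]; linarith
  rw [e2]

theorem IsUnitNormalField.abs_apply_eq_norm {Γ : Set E3} {n : E3 → E3}
    (hn : IsUnitNormalField Γ n)
    {ρ : E3 → ℝ} {ρ' : E3 →L[ℝ] ℝ} {x : E3}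
    (h : HasStrictFDerivAt ρ ρ' x) (h0 : ρ' ≠ 0) (hx : x ∈ Γ)
    (hΓ : ∀ᶠ y in 𝓝 x, y ∈ Γ ↔ ρ y = 0) : |ρ' (n x)| = ‖ρ'‖ := by
  apply le_antisymm
  · simpa [hn.norm_eq_one x hx] using ρ'.le_opNorm (n x)
  · refine ρ'.opNorm_le_bound (abs_nonneg _) fun v => ?_
    rw [hn.apply_eq h h0 hx hΓ v, norm_mul, Real.norm_eq_abs]
    gcongr
    simpa [hn.norm_eq_one x hx] using norm_inner_le_norm (𝕜 := ℝ) (n x) v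

/-- This is what makes `surfGrad` meaningful: derivatives within Γ are determined only along the
tangent cone, and `surfGrad` evaluates them only on such projections. -/
theorem tangentProj_mem_tangentConeAt {Γ : Set E3} (hΓ : IsClosedC2Surface Γ) {n : E3 → E3}
    (hn : IsUnitNormalField Γ n) {y : E3} (hy : y ∈ Γ) (v : E3) :
    tangentProj n y v ∈ tangentConeAt ℝ Γ y := by
  obtain ⟨U, hU, hyU, ρ, -, h0, hs, hiff⟩ := hΓ.exists_local_eq hy
  have hev : ∀ᶠ z in 𝓝 y, z ∈ Γ ↔ ρ z = 0 := by
    filter_upwards [hU.mem_nhds hyU] with z hz using hiff z hz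
  apply ker_subset_tangentConeAt_of_level_set (hs y hyU) (h0 y hyU) hy hev
  rw [hn.apply_eq (hs y hyU) (h0 y hyU) hy hev, tangentProj, inner_sub_right, inner_smul_right,
    real_inner_self_eq_norm_sq, hn.norm_eq_one y hy]
  ring

/-- A unit normal field of a closed `C²` surface extends to a `C¹` field on the whole space. -/
theorem IsUnitNormalField.exists_contDiff_extension {Γ : Set E3} (hΓ : IsClosedC2Surface Γ)
    {n : E3 → E3} (hn : IsUnitNormalField Γ n) :
    ∃ N : E3 → E3, ContDiff ℝ 1 N ∧ ∀ y ∈ Γ, N y = n y := by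
  classical
  -- The value n(y) is prescribed on Γ and nothing off Γ. These constraints are convex, so a
  -- partition of unity glues local C¹ solutions.
  let t : E3 → Set E3 := fun y => if y ∈ Γ then {n y} else Set.univ
  have ht : ∀ y, Convex ℝ (t y) := fun y => by
    by_cases h : y ∈ Γ <;> simp [t, h, convex_univ]
  obtain ⟨g, hg⟩ := exists_contMDiffMap_forall_mem_convex_of_local (n := 1)
    (modelWithCornersSelf ℝ E3) ht (fun x => by
    by_cases hx : x ∈ Γ
    · obtain ⟨U, hU, hxU, ρ, hC, h0, hs, hiff⟩ := hΓ.exists_local_eq hx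
      have hev : ∀ y ∈ U, ∀ᶠ z in 𝓝 y, z ∈ Γ ↔ ρ z = 0 := fun y hy => by
        filter_upwards [hU.mem_nhds hy] with z hz using hiff z hz
      let w : E3 → E3 := fun y => (InnerProductSpace.toDual ℝ E3).symm (fderiv ℝ ρ y)
      have hwC : ∀ y ∈ U, ContDiffAt ℝ 1 w y := fun y hy =>
        ((InnerProductSpace.toDual ℝ E3).symm.contDiff.contDiffAt).comp y
          ((hC y hy).fderiv_right (m := 1) (by norm_num))
      have hw0 : ∀ y ∈ U, w y ≠ 0 := fun y hy => by simpa [w] using h0 y hy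
      have hww : ∀ y ∈ U, y ∈ Γ → w y = (fderiv ℝ ρ y (n y)) • n y := fun y hy hyΓ => by
        apply ext_inner_right ℝ; intro v
        rw [inner_smul_left, conj_trivial, ← hn.apply_eq (hs y hy) (h0 y hy) hyΓ (hev y hy) v]
        simp [w]
      have hab : ∀ y ∈ U, y ∈ Γ → |fderiv ℝ ρ y (n y)| = ‖w y‖ := fun y hy hyΓ => by
        rw [hn.abs_apply_eq_norm (hs y hy) (h0 y hy) hyΓ (hev y hy)]; simp [w]
      set a : ℝ := fderiv ℝ ρ x (n x) with ha
      have ha0 : a ≠ 0 := by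
        rw [← abs_pos, hab x hxU hx]; exact norm_pos_iff.2 (hw0 x hxU)
      have hca : ContinuousWithinAt (fun y => a * fderiv ℝ ρ y (n y)) Γ x :=
        continuousWithinAt_const.mul (ContinuousWithinAt.clm_apply
          ((hC x hxU).continuousAt_fderiv (by norm_num)).continuousWithinAt
          (hn.continuousOn x hx))
      have hpos : ∀ᶠ y in 𝓝[Γ] x, 0 < a * fderiv ℝ ρ y (n y) :=
        hca.eventually (lt_mem_nhds (by simp only [← ha]; exact mul_self_pos.2 ha0))
      rw [eventually_nhdsWithin_iff] at hpos
      -- The local solution is the normalized gradient of ρ. On Γ it equals ±n; the neighbourhood is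
      -- shrunk so that, by continuity of n, the sign is the one at x.
      refine ⟨_, inter_mem (hU.mem_nhds hxU) hpos,
        fun y => (SignType.sign a : ℝ) • (‖w y‖⁻¹ • w y), ?_, ?_⟩
      · intro y hy
        apply ContMDiffAt.contMDiffWithinAt
        rw [contMDiffAt_iff_contDiffAt]
        have hy1 := hw0 y hy.1
        have hconst : ContDiffAt ℝ 1 (fun _ : E3 => (SignType.sign a : ℝ)) y := contDiffAt_const
        exact hconst.smul
          ((((hwC y hy.1).norm ℝ hy1).inv (norm_ne_zero_iff.2 hy1)).smul (hwC y hy.1))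
      · intro y hy
        by_cases hyΓ : y ∈ Γ
        · have hp := hy.2 hyΓ
          simp only [t, hyΓ, if_true, Set.mem_singleton_iff]
          set b := fderiv ℝ ρ y (n y) with hb
          rw [← hab y hy.1 hyΓ, hww y hy.1 hyΓ, ← hb, smul_smul, smul_smul]
          rcases lt_or_gt_of_ne ha0 with h | h
          · have hb' : b < 0 := by nlinarith
            rw [sign_neg h, abs_of_neg hb']
            simp only [SignType.coe_neg, SignType.coe_one]
            rw [show (-1 : ℝ) * (-b)⁻¹ * b = 1 by
              rw [inv_neg]; field_simp; exact div_self hb'.ne, one_smul]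
          · have hb' : 0 < b := by nlinarith
            rw [sign_pos h, abs_of_pos hb']
            simp only [SignType.coe_one]
            rw [show (1 : ℝ) * b⁻¹ * b = 1 by field_simp, one_smul]
        · simp [t, hyΓ]
    · refine ⟨Γᶜ, hΓ.isCompact.isClosed.isOpen_compl.mem_nhds hx, fun _ => 0,
        contMDiffOn_const, fun y hy => ?_⟩
      simp [t, show y ∉ Γ from hy])
  refine ⟨g, contMDiff_iff_contDiff.1 g.contMDiff, fun y hy => ?_⟩
  simpa [t, hy] using hg y

/-! ### Area growth and integrability of 1/|x - y| -/

theorem LipschitzOnWith.euclideanHausdorffMeasure_image_le {X Y : Type*} [MetricSpace X]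
    [MeasurableSpace X] [BorelSpace X] [MetricSpace Y] [MeasurableSpace Y] [BorelSpace Y]
    {K : ℝ≥0} {f : X → Y} {s : Set X} (h : LipschitzOnWith K f s) (d : ℕ) :
    (Measure.euclideanHausdorffMeasure d : Measure Y) (f '' s) ≤
      (K : ℝ≥0∞) ^ d * (Measure.euclideanHausdorffMeasure d : Measure X) s := by
  simp only [Measure.euclideanHausdorffMeasure_def, Measure.smul_apply]
  have := h.hausdorffMeasure_image_le (d := d) (Nat.cast_nonneg d)
  rw [ENNReal.rpow_natCast] at this
  rw [mul_smul_comm]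
  gcongr

/-- Layer cake formula: the superlevel set at height t is contained in a ball of radius 1/t, so its
measure is at most C t⁻² for t > 1/r₀, which is integrable at infinity. Lower heights cost only the
finite total mass. -/
theorem integrable_inv_dist_of_measure_ball_le {X : Type*} [MetricSpace X] [MeasurableSpace X]
    [OpensMeasurableSpace X] {μ : Measure X} [IsFiniteMeasure μ] {x : X} {C r₀ : ℝ}
    (hr₀ : 0 < r₀)
    (h : ∀ r, 0 < r → r ≤ r₀ → μ (Metric.ball x r) ≤ ENNReal.ofReal (C * r ^ 2)) :
    Integrable (fun y => (dist x y)⁻¹) μ := by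
  have hm : Measurable fun y => (dist x y)⁻¹ := (continuous_const.dist continuous_id).measurable.inv
  refine ⟨hm.aestronglyMeasurable, ?_⟩
  rw [hasFiniteIntegral_iff_ofReal (Eventually.of_forall fun y => by positivity)]
  rw [lintegral_eq_lintegral_meas_lt μ (Eventually.of_forall fun y => by positivity)
    hm.aemeasurable]
  have hT : (0 : ℝ) < r₀⁻¹ := by positivity
  rw [← Set.Ioc_union_Ioi_eq_Ioi hT.le]
  refine (lintegral_union_le _ _ _).trans_lt (ENNReal.add_lt_top.2 ⟨?_, ?_⟩)
  · calc ∫⁻ t in Set.Ioc 0 r₀⁻¹, μ {a | t < (dist x a)⁻¹}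
        ≤ ∫⁻ _ in Set.Ioc 0 r₀⁻¹, μ Set.univ := lintegral_mono fun t => measure_mono (Set.subset_univ _)
      _ < ⊤ := by
        rw [setLIntegral_const]
        exact ENNReal.mul_lt_top (measure_lt_top _ _) (by simp)
  · have hint : IntegrableOn (fun t : ℝ => C * t ^ (-2 : ℝ)) (Set.Ioi r₀⁻¹) :=
      (integrableOn_Ioi_rpow_of_lt (by norm_num) hT).const_mul C
    refine lt_of_le_of_lt (setLIntegral_mono' measurableSet_Ioi fun t ht => ?_)
      (lt_of_le_of_lt (lintegral_mono fun t => ENNReal.ofReal_le_ofReal (le_abs_self _)) ?_)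
      (b := ∫⁻ t in Set.Ioi r₀⁻¹, ENNReal.ofReal (C * t ^ (-2 : ℝ)))
    · have ht0 : 0 < t := hT.trans ht
      refine (measure_mono ?_).trans ((h t⁻¹ (by positivity) ?_).trans (le_of_eq ?_))
      · intro y hy
        have hy' : t < (dist x y)⁻¹ := hy
        rw [Metric.mem_ball, dist_comm]
        have hd : 0 < dist x y := by
          rcases (dist_nonneg (x := x) (y := y)).eq_or_lt with h | h
          · rw [← h, inv_zero] at hy'; linarith
          · exact h
        exact (lt_inv_comm₀ ht0 hd).1 hy'
      · exact (inv_lt_of_inv_lt₀ hr₀ ht).le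
      · congr 2
        rw [Real.rpow_neg ht0.le]; norm_num
    · have := hint.2
      rw [HasFiniteIntegral] at this
      refine lt_of_eq_of_lt (lintegral_congr fun t => ?_) this
      exact (Real.enorm_eq_ofReal_abs _).symm

theorem exists_surfaceMeasure_ball_le {Γ : Set E3} (hΓ : IsClosedC2Surface Γ) {x : E3}
    (hx : x ∈ Γ) : ∃ C r₀ : ℝ, 0 < r₀ ∧ ∀ r, 0 < r → r ≤ r₀ →
      surfaceMeasure Γ (Metric.ball x r) ≤ ENNReal.ofReal (C * r ^ 2) := by
  obtain ⟨U, hU, hxU, ρ, -, h0, hs, hiff⟩ := hΓ.exists_local_eq hx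
  have hev : ∀ᶠ z in 𝓝 x, z ∈ Γ ↔ ρ z = 0 := by
    filter_upwards [hU.mem_nhds hxU] with z hz using hiff z hz
  obtain ⟨ψ, hψ0, hd, -, himg⟩ := exists_param_of_level_set (hs x hxU) (h0 x hxU) hx hev
  have hρ := h0 x hxU
  generalize fderiv ℝ ρ x = ρ' at *
  have hfin : Module.finrank ℝ ρ'.ker = 2 := by
    have h1 := Module.Dual.finrank_ker_add_one_of_ne_zero 
      (f := (ρ' : E3 →ₗ[ℝ] ℝ)) (by
        intro hh; apply hρ; ext v; exact congrArg (fun l : E3 →ₗ[ℝ] ℝ => l v) hh)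
    have h2 : Module.finrank ℝ E3 = 3 := by simp
    omega
  have hhaar : (Measure.euclideanHausdorffMeasure 2 : Measure ρ'.ker).IsAddHaarMeasure := by
    rw [← hfin]; infer_instance
  -- With error constant 1/2, ψ is 2-Lipschitz and ‖u‖ ≤ 2 |ψ(u) - x|. So Γ ∩ B(x, r) is covered by
  -- the image of a disc of radius 2r, of area at most 2² · (2r)² m = 16 m r².
  obtain ⟨s, hs, hA⟩ := hd.approximates_deriv_on_nhds (c := 1 / 2) (Or.inr (by norm_num))
  have hlip : LipschitzOnWith 2 ψ s := LipschitzOnWith.of_dist_le_mul fun u hu v hv => by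
    have h1 := hA u hu v hv
    have h2 : ‖ψ u - ψ v‖ ≤ ‖ψ u - ψ v - ρ'.ker.subtypeL (u - v)‖ + ‖ρ'.ker.subtypeL (u - v)‖ := by
      simpa using norm_add_le (ψ u - ψ v - ρ'.ker.subtypeL (u - v)) (ρ'.ker.subtypeL (u - v))
    have h3 : ‖ρ'.ker.subtypeL (u - v)‖ = ‖u - v‖ := rfl
    rw [dist_eq_norm, dist_eq_norm]
    push_cast at h1 ⊢
    linarith [norm_nonneg (u - v)]
  have hs0 : (0 : ρ'.ker) ∈ s := mem_of_mem_nhds hs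
  have hlow : ∀ u ∈ s, ‖u‖ ≤ 2 * dist (ψ u) x := fun u hu => by
    have h1 := hA u hu 0 hs0
    have h2 : ‖ρ'.ker.subtypeL (u - 0)‖ ≤ ‖ψ u - ψ 0‖ + ‖ψ u - ψ 0 - ρ'.ker.subtypeL (u - 0)‖ := by
      simpa using norm_sub_le (ψ u - ψ 0) (ψ u - ψ 0 - ρ'.ker.subtypeL (u - 0))
    have h3 : ‖ρ'.ker.subtypeL (u - 0)‖ = ‖u - 0‖ := rfl
    rw [dist_eq_norm, ← hψ0]
    rw [h3, sub_zero] at h2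
    rw [sub_zero] at h1
    push_cast at h1
    linarith
  obtain ⟨r₀, hr₀, hb⟩ := Metric.mem_nhdsWithin_iff.1 (himg s hs)
  set m := (Measure.euclideanHausdorffMeasure 2 : Measure ρ'.ker) (Metric.ball 0 1) with hm
  have hmtop : m ≠ ⊤ := Metric.isBounded_ball.measure_lt_top.ne
  have hnt : Nontrivial ρ'.ker := Module.nontrivial_of_finrank_pos (R := ℝ) (by omega)
  refine ⟨16 * m.toReal, r₀, hr₀, fun r hr hrr => ?_⟩
  rw [surfaceMeasure, Measure.restrict_apply Metric.isOpen_ball.measurableSet]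
  calc (Measure.euclideanHausdorffMeasure 2 : Measure E3) (Metric.ball x r ∩ Γ)
      ≤ (Measure.euclideanHausdorffMeasure 2 : Measure E3) (ψ '' (s ∩ Metric.ball 0 (2 * r))) := by
        apply measure_mono
        intro y hy
        obtain ⟨u, hu, rfl⟩ := hb ⟨Metric.ball_subset_ball hrr hy.1, hy.2⟩
        refine ⟨u, ⟨hu, ?_⟩, rfl⟩
        have := hlow u hu
        have h5 : dist (ψ u) x < r := hy.1
        rw [mem_ball_zero_iff]; linarith
    _ ≤ ((2 : ℝ≥0) : ℝ≥0∞) ^ 2 * (Measure.euclideanHausdorffMeasure 2 : Measure ρ'.ker)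
          (s ∩ Metric.ball 0 (2 * r)) :=
        (hlip.mono Set.inter_subset_left).euclideanHausdorffMeasure_image_le 2
    _ ≤ ((2 : ℝ≥0) : ℝ≥0∞) ^ 2 * (Measure.euclideanHausdorffMeasure 2 : Measure ρ'.ker)
          (Metric.ball 0 (2 * r)) := by
        gcongr; exact Set.inter_subset_right
    _ = ENNReal.ofReal (16 * m.toReal * r ^ 2) := by
        rw [Measure.addHaar_ball _ _ (by positivity), hfin, ← hm]
        rw [← ENNReal.ofReal_toReal hmtop, ENNReal.toReal_ofReal ENNReal.toReal_nonneg]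
        rw [← ENNReal.ofReal_mul (by positivity)]
        rw [show ((2 : ℝ≥0) : ℝ≥0∞) ^ 2 = ENNReal.ofReal 4 by
          rw [ENNReal.ofReal_ofNat]; norm_num]
        rw [← ENNReal.ofReal_mul (by norm_num)]
        congr 1; ring

theorem IsClosedC2Surface.isFiniteMeasure {Γ : Set E3} (hΓ : IsClosedC2Surface Γ) :
    IsFiniteMeasure (surfaceMeasure Γ) := by
  refine ⟨?_⟩
  have h : surfaceMeasure Γ Γ < ⊤ := hΓ.isCompact.measure_lt_top_of_nhdsWithin fun x hx => by
    obtain ⟨C, r₀, hr₀, h⟩ := exists_surfaceMeasure_ball_le hΓ hx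
    exact ⟨Metric.ball x r₀, nhdsWithin_le_nhds (Metric.ball_mem_nhds x hr₀),
      (h r₀ hr₀ le_rfl).trans_lt ENNReal.ofReal_lt_top⟩
  rw [surfaceMeasure, Measure.restrict_apply hΓ.isCompact.measurableSet, Set.inter_self] at h
  rwa [surfaceMeasure, Measure.restrict_apply_univ]

theorem IsClosedC2Surface.integrable_inv_dist {Γ : Set E3} (hΓ : IsClosedC2Surface Γ) {x : E3}
    (hx : x ∈ Γ) : Integrable (fun y => (dist x y)⁻¹) (surfaceMeasure Γ) := by
  have := hΓ.isFiniteMeasure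
  obtain ⟨C, r₀, hr₀, h⟩ := exists_surfaceMeasure_ball_le hΓ hx
  exact integrable_inv_dist_of_measure_ball_le hr₀ h

theorem ae_surfaceMeasure_mem {Γ : Set E3} (hΓ : IsClosedC2Surface Γ) :
    ∀ᵐ y ∂(surfaceMeasure Γ), y ∈ Γ := ae_restrict_mem hΓ.isCompact.measurableSet

theorem ae_surfaceMeasure_ne (Γ : Set E3) (x : E3) : ∀ᵐ y ∂(surfaceMeasure Γ), y ≠ x := by
  have : (Measure.euclideanHausdorffMeasure 2 : Measure E3) {x} = 0 := by
    rw [Measure.euclideanHausdorffMeasure_def, Measure.smul_apply,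
      @measure_singleton _ _ _ (Measure.nullSingletonClass_hausdorff E3 (by norm_num)), smul_zero]
  exact ae_restrict_of_ae (by rw [ae_iff]; simpa using this)

/-! ### Chords and nontangential approach -/

/-- On a closed `C²` surface the chords are tangential up to second order, uniformly. -/
theorem IsUnitNormalField.exists_abs_inner_le {Γ : Set E3} (hΓ : IsClosedC2Surface Γ)
    {n : E3 → E3} (hn : IsUnitNormalField Γ n) :
    ∃ C : ℝ, 0 < C ∧ ∀ x ∈ Γ, ∀ y ∈ Γ, |⟪n y, x - y⟫| ≤ C * dist x y ^ 2 := by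
  let p : Set (E3 × E3) → Prop := fun S => ∃ C : ℝ, 0 < C ∧
    ∀ q ∈ S, q.1 ∈ Γ → q.2 ∈ Γ → |⟪n q.2, q.1 - q.2⟫| ≤ C * dist q.1 q.2 ^ 2
  suffices h : p (Γ ×ˢ Γ) by
    obtain ⟨C, hC, h⟩ := h
    exact ⟨C, hC, fun x hx y hy => h (x, y) ⟨hx, hy⟩ hx hy⟩
  -- Compactness of Γ × Γ reduces the bound to neighbourhoods of single pairs. Near the diagonal it
  -- is Taylor's formula for ρ, which vanishes at both endpoints; away from the diagonal the
  -- distance is bounded below and Cauchy–Schwarz suffices.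
  refine (hΓ.isCompact.prod hΓ.isCompact).induction_on (p := p) ⟨1, one_pos, by simp⟩ ?_ ?_ ?_
  · rintro s t hst ⟨C, hC, h⟩
    exact ⟨C, hC, fun q hq => h q (hst hq)⟩
  · rintro s t ⟨C, hC, h⟩ ⟨C', hC', h'⟩
    refine ⟨C + C', by positivity, fun q hq h1 h2 => ?_⟩
    have hd : 0 ≤ dist q.1 q.2 ^ 2 := by positivity
    rcases hq with hq | hq
    · have := h q hq h1 h2; nlinarith
    · have := h' q hq h1 h2; nlinarith
  · rintro ⟨x, y⟩ ⟨hx, hy⟩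
    by_cases hxy : x = y
    · subst hxy
      obtain ⟨U, hU, hxU, ρ, hC, h0, hs, hiff⟩ := hΓ.exists_local_eq hx
      obtain ⟨K, t, ht, hK⟩ := ((hC x hxU).fderiv_right (m := 1) (by norm_num)).exists_lipschitzOnWith
      have hpos : 0 < ‖fderiv ℝ ρ x‖ := norm_pos_iff.2 (h0 x hxU)
      have hlow : ∀ᶠ z in 𝓝 x, ‖fderiv ℝ ρ x‖ / 2 < ‖fderiv ℝ ρ z‖ :=
        ((hC x hxU).continuousAt_fderiv (by norm_num)).norm.eventually
          (lt_mem_nhds (by simpa using half_lt_self hpos))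
      obtain ⟨r, hr, hball⟩ := Metric.mem_nhds_iff.1 (inter_mem (inter_mem (hU.mem_nhds hxU) ht) hlow)
      refine ⟨Metric.ball x r ×ˢ Metric.ball x r, nhdsWithin_le_nhds
        (prod_mem_nhds (Metric.ball_mem_nhds x hr) (Metric.ball_mem_nhds x hr)),
        (K + 1) / (‖fderiv ℝ ρ x‖ / 2), by positivity, ?_⟩
      rintro ⟨a, b⟩ ⟨ha, hb⟩ haΓ hbΓ
      dsimp only at *
      have hbU := (hball hb).1.1
      have hev : ∀ᶠ z in 𝓝 b, z ∈ Γ ↔ ρ z = 0 := by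
        filter_upwards [hU.mem_nhds hbU] with z hz using hiff z hz
      have hseg : segment ℝ b a ⊆ Metric.ball x r := (convex_ball x r).segment_subset hb ha
      have h1 := (convex_segment b a).norm_image_sub_le_of_norm_hasFDerivWithin_le'
        (f := ρ) (f' := fderiv ℝ ρ) (φ := fderiv ℝ ρ b) (C := K * dist a b)
        (fun z hz => (hs z (hball (hseg hz)).1.1).hasFDerivAt.hasFDerivWithinAt)
        (fun z hz => by
          rw [← dist_eq_norm]
          refine (hK.dist_le_mul z (hball (hseg hz)).1.2 b (hball hb).1.2).trans ?_
          gcongr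
          rw [dist_eq_norm, dist_eq_norm]
          exact norm_sub_le_of_mem_segment hz)
        (left_mem_segment ℝ b a) (right_mem_segment ℝ b a)
      rw [(hiff a (hball ha).1.1).1 haΓ, (hiff b hbU).1 hbΓ, sub_self, zero_sub, norm_neg,
        hn.apply_eq (hs b hbU) (h0 b hbU) hbΓ hev, norm_mul, Real.norm_eq_abs,
        hn.abs_apply_eq_norm (hs b hbU) (h0 b hbU) hbΓ hev, ← dist_eq_norm, Real.norm_eq_abs] at h1
      have h2 := (hball hb).2
      have h2' : ‖fderiv ℝ ρ x‖ / 2 < ‖fderiv ℝ ρ b‖ := h2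
      rw [div_mul_eq_mul_div, le_div_iff₀ (by positivity)]
      have h3 : |⟪n b, a - b⟫| * (‖fderiv ℝ ρ x‖ / 2) ≤ ‖fderiv ℝ ρ b‖ * |⟪n b, a - b⟫| := by
        rw [mul_comm]; gcongr
      nlinarith [sq_nonneg (dist a b)]
    · have hd : 0 < dist x y := dist_pos.2 hxy
      have hev : ∀ᶠ q : E3 × E3 in 𝓝 (x, y), dist x y / 2 < dist q.1 q.2 :=
        continuous_dist.continuousAt.eventually (lt_mem_nhds (by simpa using half_lt_self hd))
      refine ⟨_, nhdsWithin_le_nhds hev, 2 / dist x y, by positivity, fun q hq h1 h2 => ?_⟩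
      have hq' : dist x y / 2 < dist q.1 q.2 := hq
      have h3 := abs_real_inner_le_norm (n q.2) (q.1 - q.2)
      rw [hn.norm_eq_one _ h2, one_mul, ← dist_eq_norm] at h3
      refine h3.trans ?_
      rw [div_mul_eq_mul_div, le_div_iff₀ hd]
      nlinarith

/-- Expanding, |x + h n - y|² = |x - y|² - 2h n · (y - x) + h². The chord estimate bounds the cross
term by 2|h| C |x - y|², at most half of |x - y|² once |h| < 1/(4C). This comparison supplies
dominating functions independent of h. -/
theorem IsUnitNormalField.eventually_dist_le_dist_add_smul {Γ : Set E3}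
    (hΓ : IsClosedC2Surface Γ) {n : E3 → E3} (hn : IsUnitNormalField Γ n) {x : E3} (hx : x ∈ Γ) :
    ∀ᶠ h : ℝ in 𝓝 0, ∀ y ∈ Γ, dist x y ≤ 2 * dist (x + h • n x) y := by
  obtain ⟨C, hC, hb⟩ := hn.exists_abs_inner_le hΓ
  have hev : ∀ᶠ h : ℝ in 𝓝 0, |h| < 1 / (4 * C) := by
    have := (continuous_abs (G := ℝ)).tendsto 0
    rw [abs_zero] at this
    exact this.eventually (gt_mem_nhds (by positivity))
  filter_upwards [hev] with h hh y hy
  rw [lt_div_iff₀ (by positivity)] at hh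
  have h1 := hb y hy x hx
  have h2 : dist (x + h • n x) y ^ 2 = dist x y ^ 2 - 2 * h * ⟪n x, y - x⟫ + h ^ 2 := by
    rw [dist_eq_norm, dist_eq_norm, ← neg_sub y x, norm_neg,
      show x + h • n x - y = h • n x - (y - x) by abel, norm_sub_sq_real, inner_smul_left,
      norm_smul, hn.norm_eq_one x hx, mul_one, Real.norm_eq_abs, sq_abs, conj_trivial]
    ring
  have h3 : h * ⟪n x, y - x⟫ ≤ |h| * (C * dist x y ^ 2) := by
    refine (le_abs_self _).trans ?_
    rw [abs_mul, dist_comm x y]; gcongr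
  have h4 : |h| * (C * dist x y ^ 2) ≤ dist x y ^ 2 / 4 := by
    nlinarith [sq_nonneg (dist x y)]
  refine le_of_sq_le_sq ?_ (by positivity)
  nlinarith [sq_nonneg h, sq_nonneg (dist x y)]

/-! ### The Green's function as a radial function -/

theorem hasFDerivAt_dist_left {y z : E3} (h : z ≠ y) :
    HasFDerivAt (fun z => dist z y) ((dist z y)⁻¹ • innerSL ℝ (z - y)) z := by
  have h0 : dist z y ≠ 0 := dist_ne_zero.2 h
  have h1 : HasFDerivAt (fun z => ‖z - y‖ ^ 2) (2 • (innerSL ℝ (z - y)).comp (.id ℝ E3)) z :=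
    ((hasFDerivAt_id z).sub_const y).norm_sq
  have h2 := h1.sqrt (by rw [← dist_eq_norm]; positivity)
  refine (h2.congr_of_eventuallyEq (Eventually.of_forall fun w => ?_)).congr_fderiv ?_
  · simp [dist_eq_norm, Real.sqrt_sq]
  · ext v
    simp only [← dist_eq_norm, Real.sqrt_sq dist_nonneg, ContinuousLinearMap.comp_id,
      smul_apply, smul_eq_mul, nsmul_eq_mul]
    push_cast
    field_simp

theorem hasFDerivAt_comp_dist_left {P : ℝ → ℂ} {p : ℂ} {y z : E3} (h : z ≠ y)
    (hP : HasDerivAt P p (dist z y)) :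
    HasFDerivAt (fun z => P (dist z y)) ((innerSL ℝ (z - y)).smulRight (p / dist z y)) z := by
  refine (hP.hasFDerivAt.comp z (hasFDerivAt_dist_left h)).congr_fderiv ?_
  ext v
  simp
  ring

theorem hasFDerivAt_comp_dist_right {P : ℝ → ℂ} {p : ℂ} {y z : E3} (h : z ≠ y)
    (hP : HasDerivAt P p (dist z y)) :
    HasFDerivAt (fun y => P (dist z y)) ((innerSL ℝ (y - z)).smulRight (p / dist z y)) y := by
  simp_rw [dist_comm z] at hP ⊢
  exact hasFDerivAt_comp_dist_left h.symm hP

/-- The radial profile of the Green's function. -/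
def greenRadial (κ r : ℝ) : ℂ :=
  Complex.exp (Complex.I * (κ : ℂ) * (r : ℂ)) / (4 * (Real.pi : ℂ) * (r : ℂ))

/-- The derivative of the radial profile of the Green's function. -/
def greenRadialDeriv (κ r : ℝ) : ℂ :=
  Complex.exp (Complex.I * (κ : ℂ) * (r : ℂ)) * (Complex.I * κ * r - 1) /
    (4 * (Real.pi : ℂ) * (r : ℂ) ^ 2)

theorem hasDerivAt_greenRadial (κ : ℝ) {r : ℝ} (hr : r ≠ 0) :
    HasDerivAt (greenRadial κ) (greenRadialDeriv κ r) r := by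
  have hπ : (Real.pi : ℂ) ≠ 0 := by exact_mod_cast Real.pi_ne_zero
  have hr' : (r : ℂ) ≠ 0 := by exact_mod_cast hr
  have h1 : HasDerivAt (fun s : ℂ => Complex.exp (Complex.I * (κ : ℂ) * s) / (4 * (Real.pi : ℂ) * s))
      (greenRadialDeriv κ r) (r : ℂ) := by
    have ha := ((hasDerivAt_id (r : ℂ)).const_mul (Complex.I * (κ : ℂ))).cexp
    have hb := (hasDerivAt_id (r : ℂ)).const_mul (4 * (Real.pi : ℂ))
    refine (ha.div hb (by simp [hπ, hr'])).congr_deriv ?_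
    simp only [greenRadialDeriv, id]
    field_simp
  exact h1.comp_ofReal

theorem greenRadial_continuousAt (κ : ℝ) {r : ℝ} (hr : r ≠ 0) : ContinuousAt (greenRadial κ) r :=
  (hasDerivAt_greenRadial κ hr).continuousAt

theorem greenRadialDeriv_continuousAt (κ : ℝ) {r : ℝ} (hr : r ≠ 0) :
    ContinuousAt (greenRadialDeriv κ) r := by
  have hπ : (Real.pi : ℂ) ≠ 0 := by exact_mod_cast Real.pi_ne_zero
  have hr' : (r : ℂ) ≠ 0 := by exact_mod_cast hr
  unfold greenRadialDeriv
  exact ContinuousAt.div (by fun_prop) (by fun_prop) (by simp [hπ, hr'])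

theorem measurable_greenRadial (κ : ℝ) : Measurable (greenRadial κ) := by
  unfold greenRadial; fun_prop

theorem measurable_greenRadialDeriv (κ : ℝ) : Measurable (greenRadialDeriv κ) := by
  unfold greenRadialDeriv; fun_prop

theorem norm_exp_I_mul_mul (κ r : ℝ) : ‖Complex.exp (Complex.I * (κ : ℂ) * (r : ℂ))‖ = 1 := by
  rw [show Complex.I * (κ : ℂ) * (r : ℂ) = ((κ * r : ℝ) : ℂ) * Complex.I by push_cast; ring]
  exact Complex.norm_exp_ofReal_mul_I _

theorem one_le_four_mul_pi : 1 ≤ 4 * Real.pi := by linarith [Real.pi_gt_three]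

theorem norm_greenRadial_le (κ : ℝ) {r : ℝ} (hr : 0 < r) : ‖greenRadial κ r‖ ≤ r⁻¹ := by
  rw [greenRadial, norm_div, norm_exp_I_mul_mul, norm_mul, norm_mul, Complex.norm_real,
    Complex.norm_real, Real.norm_of_nonneg Real.pi_pos.le, Real.norm_of_nonneg hr.le,
    Complex.norm_ofNat, ← one_div]
  exact one_div_le_one_div_of_le hr (le_mul_of_one_le_left hr.le one_le_four_mul_pi)

theorem norm_greenRadialDeriv_le (κ : ℝ) {r : ℝ} (hr : 0 < r) :
    ‖greenRadialDeriv κ r‖ ≤ (|κ| * r + 1) * (r⁻¹) ^ 2 := by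
  rw [greenRadialDeriv, norm_div, norm_mul, norm_exp_I_mul_mul, norm_mul, norm_mul, norm_pow,
    Complex.norm_real, Complex.norm_real, Real.norm_of_nonneg Real.pi_pos.le,
    Real.norm_of_nonneg hr.le, Complex.norm_ofNat, one_mul, div_eq_mul_inv]
  have h1 : ‖Complex.I * κ * r - 1‖ ≤ |κ| * r + 1 := by
    refine (norm_sub_le _ _).trans_eq ?_
    simp [abs_of_pos hr]
  have h2 : (4 * Real.pi * r ^ 2)⁻¹ ≤ (r⁻¹) ^ 2 := by
    rw [inv_pow]
    exact inv_anti₀ (by positivity) (le_mul_of_one_le_left (by positivity) one_le_four_mul_pi)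
  gcongr

theorem hasFDerivAt_green_left (κ : ℝ) {z y : E3} (h : z ≠ y) :
    HasFDerivAt (fun z => green κ z y)
      ((innerSL ℝ (z - y)).smulRight (greenRadialDeriv κ (dist z y) / dist z y)) z :=
  hasFDerivAt_comp_dist_left h (hasDerivAt_greenRadial κ (dist_ne_zero.2 h))

/-- The radial form isolates the factor (y - z) · n(y), which is of second order when both points
lie on Γ. -/
theorem greenNormalDeriv_eq (κ : ℝ) (n : E3 → E3) {z y : E3} (h : z ≠ y) :
    greenNormalDeriv κ n z y =
      ((⟪y - z, n y⟫ : ℝ) : ℂ) * (greenRadialDeriv κ (dist z y) / dist z y) := by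
  have h1 : HasFDerivAt (fun y => green κ z y) _ y :=
    hasFDerivAt_comp_dist_right h (hasDerivAt_greenRadial κ (dist_ne_zero.2 h))
  rw [greenNormalDeriv, h1.fderiv]
  simp [inner_sub_left]

/-! ### Algebra of the curl and of surface gradients -/

theorem inner_E3 (u v : E3) : ⟪u, v⟫ = u 0 * v 0 + u 1 * v 1 + u 2 * v 2 := by
  simp [PiLp.inner_apply, Fin.sum_univ_three]; ring

/-- The functional `A' ↦ v ⬝ ∇ × A`, where `A'` is the derivative of `A`. -/
def dotCurl (v : C3) : (E3 →L[ℝ] C3) →L[ℝ] ℂ :=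
  LinearMap.toContinuousLinearMap
    { toFun := fun A => v ⬝ᵥ ![A (EuclideanSpace.single 1 1) 2 - A (EuclideanSpace.single 2 1) 1,
        A (EuclideanSpace.single 2 1) 0 - A (EuclideanSpace.single 0 1) 2,
        A (EuclideanSpace.single 0 1) 1 - A (EuclideanSpace.single 1 1) 0]
      map_add' := fun A B => by
        simp [dotProduct, Fin.sum_univ_three]; ring
      map_smul' := fun c A => by
        simp [dotProduct, Fin.sum_univ_three]; ring }

theorem dotProduct_curl (v : C3) (A : E3 → C3) (x : E3) :
    v ⬝ᵥ curl A x = dotCurl v (fderiv ℝ A x) := rfl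

theorem hasFDerivAt_green_smul (κ : ℝ) (a : C3) {z y : E3} (h : z ≠ y) :
    HasFDerivAt (fun z => green κ z y • a)
      ((((innerSL ℝ (z - y)).smulRight (greenRadialDeriv κ (dist z y) / dist z y)).smulRight a)) z :=
  (hasFDerivAt_green_left κ h).smul_const a

/-- The integrand of the curl of the single layer potential, decomposed by the tangential field
`n × J`. -/
theorem dotProduct_curl_green_smul (κ : ℝ) {n : E3 → E3} {J : E3 → C3} {y z : E3} (w : E3)
    (h : z ≠ y) (hn : ‖n y‖ = 1) (hJ : toC3 (n y) ⬝ᵥ J y = 0) :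
    toC3 w ⬝ᵥ curl (fun z => green κ z y • J y) z =
      -(toC3 w ⬝ᵥ doubleTerm n κ J z y) +
        (toC3 w ⬝ᵥ toC3 (n y)) * (greenRadialDeriv κ (dist z y) / dist z y *
          (toC3 (y - z) ⬝ᵥ nCross n J y)) := by
  rw [dotProduct_curl, (hasFDerivAt_green_smul κ (J y) h).fderiv, doubleTerm,
    greenNormalDeriv_eq κ n h]
  generalize greenRadialDeriv κ (dist z y) / (dist z y : ℂ) = k
  have hnn : (n y 0 : ℂ) ^ 2 + (n y 1 : ℂ) ^ 2 + (n y 2 : ℂ) ^ 2 = 1 := by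
    have h1 := real_inner_self_eq_norm_sq (n y)
    rw [inner_E3, hn] at h1
    have h2 : n y 0 ^ 2 + n y 1 ^ 2 + n y 2 ^ 2 = 1 := by linarith
    rw [← Complex.ofReal_one, ← h2]; push_cast; ring
  have h0 : nCross n J y 0 = n y 1 * J y 2 - n y 2 * J y 1 := by
    simp [nCross, toC3, cross_apply]
  have h1 : nCross n J y 1 = n y 2 * J y 0 - n y 0 * J y 2 := by
    simp [nCross, toC3, cross_apply]
  have h2 : nCross n J y 2 = n y 0 * J y 1 - n y 1 * J y 0 := by
    simp [nCross, toC3, cross_apply]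
  simp only [dotProduct, Fin.sum_univ_three, toC3] at hJ
  -- The components of J = F × n, from n · n = 1 and n · J = 0. Substituting them leaves a
  -- polynomial identity, the triple product expansion.
  have e0 : J y 0 = nCross n J y 1 * n y 2 - nCross n J y 2 * n y 1 := by
    rw [h1, h2]; linear_combination (-(J y 0)) * hnn + (n y 0 : ℂ) * hJ
  have e1 : J y 1 = nCross n J y 2 * n y 0 - nCross n J y 0 * n y 2 := by
    rw [h0, h2]; linear_combination (-(J y 1)) * hnn + (n y 1 : ℂ) * hJ
  have e2 : J y 2 = nCross n J y 0 * n y 1 - nCross n J y 1 * n y 0 := by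
    rw [h0, h1]; linear_combination (-(J y 2)) * hnn + (n y 2 : ℂ) * hJ
  generalize nCross n J y = F at *
  simp [dotCurl, dotProduct, Fin.sum_univ_three, toC3, inner_E3]
  rw [e0, e1, e2]
  ring

/-- The normal part removed by the projection pairs to zero with a tangential F, so the ambient
derivative of any differentiable extension may be used. -/
theorem surfGrad_dotProduct {Γ : Set E3} (hΓ : IsClosedC2Surface Γ) {n : E3 → E3}
    (hn : IsUnitNormalField Γ n) {f φ : E3 → ℂ} {y : E3} (hy : y ∈ Γ)
    (hφ : DifferentiableAt ℝ φ y) (hf : ∀ z ∈ Γ, f z = φ z) {F : C3}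
    (hF : toC3 (n y) ⬝ᵥ F = 0) :
    surfGrad Γ n f y ⬝ᵥ F = ∑ i, fderiv ℝ φ y (EuclideanSpace.single i 1) * F i := by
  have h1 : fderivWithin ℝ f Γ y = fderivWithin ℝ φ Γ y := fderivWithin_congr hf (hf y hy)
  have h2 : ∀ v, fderivWithin ℝ f Γ y (tangentProj n y v) =
      fderiv ℝ φ y v - (⟪n y, v⟫ : ℝ) • fderiv ℝ φ y (n y) := fun v => by
    rw [h1, hφ.differentiableWithinAt.hasFDerivWithinAt.unique_on hφ.hasFDerivAt.hasFDerivWithinAt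
      (tangentProj_mem_tangentConeAt hΓ hn hy v), tangentProj, map_sub, map_smul]
  simp only [dotProduct, Fin.sum_univ_three, toC3] at hF
  simp only [surfGrad, h2, dotProduct, Fin.sum_univ_three]
  simp [inner_E3]
  linear_combination (-(fderiv ℝ φ y (n y))) * hF

/-! ### Smooth truncation of the Green's function -/

/-- A `C¹` approximation of `max r ε`, constant for `r ≤ ε - δ` and equal to `r` for `ε ≤ r`. -/
def smoothMax (ε δ r : ℝ) : ℝ :=
  ε - δ / 2 + ((max (r - ε + δ) 0) ^ 2 - (max (r - ε) 0) ^ 2) / (2 * δ)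

/-- The derivative of `smoothMax`. -/
def smoothMaxDeriv (ε δ r : ℝ) : ℝ := (max (r - ε + δ) 0 - max (r - ε) 0) / δ

theorem hasDerivAt_max_zero_sq (t : ℝ) :
    HasDerivAt (fun t : ℝ => (max t 0) ^ 2) (2 * max t 0) t := by
  rcases lt_trichotomy t 0 with h | rfl | h
  · rw [max_eq_right h.le, mul_zero]
    refine (hasDerivAt_const t (0 : ℝ)).congr_of_eventuallyEq ?_
    filter_upwards [gt_mem_nhds h] with s hs
    simp [max_eq_right hs.le]
  · rw [max_self, mul_zero, hasDerivAt_iff_isLittleO]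
    have h1 : (fun t : ℝ => t ^ 2) =o[𝓝 0] fun t => t := by
      simpa using Asymptotics.isLittleO_pow_pow (𝕜 := ℝ) (m := 1) (n := 2) (by norm_num)
    refine (Asymptotics.IsBigO.of_bound 1 (Eventually.of_forall fun s => ?_)).trans_isLittleO
      (by simpa using h1)
    simp only [max_self, Real.norm_eq_abs, sub_zero, smul_zero, one_mul, abs_pow, ne_eq,
      OfNat.ofNat_ne_zero, not_false_eq_true, zero_pow]
    refine pow_le_pow_left₀ (abs_nonneg _) ?_ 2
    rcases le_total s 0 with h | h
    · simp [max_eq_right h]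
    · simp [max_eq_left h]
  · rw [max_eq_left h.le]
    refine (by simpa using hasDerivAt_pow 2 t :
      HasDerivAt (fun t : ℝ => t ^ 2) (2 * t) t).congr_of_eventuallyEq ?_
    filter_upwards [lt_mem_nhds h] with s hs
    simp [max_eq_left hs.le]

theorem hasDerivAt_smoothMax (ε δ r : ℝ) :
    HasDerivAt (smoothMax ε δ) (smoothMaxDeriv ε δ r) r := by
  have h1 : HasDerivAt (fun r : ℝ => (max (r - ε + δ) 0) ^ 2) (2 * max (r - ε + δ) 0) r := by
    have := (hasDerivAt_max_zero_sq (r - ε + δ)).comp r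
      (((hasDerivAt_id r).sub_const ε).add_const δ)
    simpa [Function.comp_def] using this
  have h2 : HasDerivAt (fun r : ℝ => (max (r - ε) 0) ^ 2) (2 * max (r - ε) 0) r := by
    have := (hasDerivAt_max_zero_sq (r - ε)).comp r ((hasDerivAt_id r).sub_const ε)
    simpa [Function.comp_def] using this
  refine (((h1.sub h2).div_const (2 * δ)).const_add (ε - δ / 2)).congr_deriv ?_
  rw [smoothMaxDeriv, ← mul_sub, mul_div_mul_left _ _ two_ne_zero]

theorem continuous_smoothMaxDeriv (ε δ : ℝ) : Continuous (smoothMaxDeriv ε δ) := by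
  unfold smoothMaxDeriv; fun_prop

theorem contDiff_smoothMax (ε δ : ℝ) : ContDiff ℝ 1 (smoothMax ε δ) := by
  rw [contDiff_one_iff_deriv]
  refine ⟨fun r => (hasDerivAt_smoothMax ε δ r).differentiableAt, ?_⟩
  rw [show deriv (smoothMax ε δ) = smoothMaxDeriv ε δ from
    funext fun r => (hasDerivAt_smoothMax ε δ r).deriv]
  exact continuous_smoothMaxDeriv ε δ

theorem smoothMax_of_le {ε δ r : ℝ} (hδ : 0 < δ) (h : ε ≤ r) : smoothMax ε δ r = r := by
  rw [smoothMax, max_eq_left (by linarith), max_eq_left (by linarith)]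
  field_simp; ring

theorem smoothMaxDeriv_of_le {ε δ r : ℝ} (hδ : 0 < δ) (h : ε ≤ r) : smoothMaxDeriv ε δ r = 1 := by
  rw [smoothMaxDeriv, max_eq_left (by linarith), max_eq_left (by linarith)]
  field_simp; ring

theorem smoothMax_of_le_sub {ε δ r : ℝ} (hδ : 0 < δ) (h : r ≤ ε - δ) :
    smoothMax ε δ r = ε - δ / 2 := by
  rw [smoothMax, max_eq_right (by linarith), max_eq_right (by linarith)]
  simp

theorem smoothMaxDeriv_of_le_sub {ε δ r : ℝ} (hδ : 0 < δ) (h : r ≤ ε - δ) :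
    smoothMaxDeriv ε δ r = 0 := by
  rw [smoothMaxDeriv, max_eq_right (by linarith), max_eq_right (by linarith)]
  simp

theorem smoothMaxDeriv_mem_Icc {ε δ : ℝ} (hδ : 0 < δ) (r : ℝ) :
    smoothMaxDeriv ε δ r ∈ Set.Icc (0 : ℝ) 1 := by
  rw [smoothMaxDeriv]
  constructor
  · apply div_nonneg _ hδ.le
    exact sub_nonneg.2 (max_le_max_right 0 (by linarith))
  · rw [div_le_one hδ, sub_le_iff_le_add]
    apply max_le
    · linarith [le_max_left (r - ε) 0]
    · linarith [le_max_right (r - ε) 0]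

theorem le_smoothMax {ε δ : ℝ} (hδ : 0 < δ) (r : ℝ) : ε - δ / 2 ≤ smoothMax ε δ r := by
  rw [smoothMax, le_add_iff_nonneg_right]
  apply div_nonneg _ (by positivity)
  rw [sub_nonneg]
  gcongr
  linarith

theorem contDiffAt_greenRadial (κ : ℝ) {r : ℝ} (hr : r ≠ 0) : ContDiffAt ℝ 1 (greenRadial κ) r := by
  have hπ : (Real.pi : ℂ) ≠ 0 := by exact_mod_cast Real.pi_ne_zero
  have hr' : (r : ℂ) ≠ 0 := by exact_mod_cast hr
  have ho : ContDiffAt ℝ 1 (fun r : ℝ => (r : ℂ)) r := Complex.ofRealCLM.contDiff.contDiffAt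
  unfold greenRadial
  simp_rw [div_eq_mul_inv]
  exact ((contDiffAt_const.mul ho).cexp).mul ((contDiffAt_const.mul ho).inv (by simp [hπ, hr']))

theorem contDiff_greenRadial_smoothMax (κ : ℝ) {ε δ : ℝ} (hδ : 0 < δ) (hδε : δ < ε) :
    ContDiff ℝ 1 fun r => greenRadial κ (smoothMax ε δ r) := by
  rw [contDiff_iff_contDiffAt]
  intro r
  have h := le_smoothMax (ε := ε) hδ r
  exact (contDiffAt_greenRadial κ (by linarith)).comp r (contDiff_smoothMax ε δ).contDiffAt

/-- The distance fails to be differentiable only at y = z, and there the profile is locally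
constant. -/
theorem contDiff_greenRadial_smoothMax_dist (κ : ℝ) {ε δ : ℝ} (hδ : 0 < δ) (hδε : δ < ε) (z : E3) :
    ContDiff ℝ 1 fun y => greenRadial κ (smoothMax ε δ (dist z y)) := by
  rw [contDiff_iff_contDiffAt]
  intro y
  by_cases h : z = y
  · subst h
    refine (contDiffAt_const (c := greenRadial κ (ε - δ / 2))).congr_of_eventuallyEq ?_
    filter_upwards [Metric.ball_mem_nhds z (sub_pos.2 hδε)] with y hy
    rw [smoothMax_of_le_sub hδ]
    rw [dist_comm]; exact (Metric.mem_ball.1 hy).le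
  · exact (contDiff_greenRadial_smoothMax κ hδ hδε).contDiffAt.comp y
      (contDiffAt_const.dist ℝ contDiffAt_id h)

theorem hasDerivAt_greenRadial_smoothMax (κ : ℝ) {ε δ : ℝ} (hδ : 0 < δ) (hδε : δ < ε) (r : ℝ) :
    HasDerivAt (fun r => greenRadial κ (smoothMax ε δ r))
      (greenRadialDeriv κ (smoothMax ε δ r) * smoothMaxDeriv ε δ r) r := by
  have h := le_smoothMax (ε := ε) hδ r
  have := (hasDerivAt_greenRadial κ (r := smoothMax ε δ r) (by linarith)).scomp r
    (hasDerivAt_smoothMax ε δ r)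
  refine this.congr_deriv ?_
  rw [Complex.real_smul, mul_comm]

theorem tendsto_greenRadial_smoothMax (κ : ℝ) {ε : ℝ} (hε : 0 < ε) (r : ℝ) :
    Tendsto (fun δ => greenRadial κ (smoothMax ε δ r)) (𝓝[>] 0)
      (𝓝 (greenRadial κ (max r ε))) := by
  rcases le_or_gt ε r with h | h
  · rw [max_eq_left h]
    refine tendsto_const_nhds.congr' ?_
    filter_upwards [self_mem_nhdsWithin] with δ hδ
    rw [smoothMax_of_le hδ h]
  · rw [max_eq_right h.le]
    have h1 : Tendsto (fun δ : ℝ => ε - δ / 2) (𝓝[>] 0) (𝓝 ε) := by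
      have hc : Continuous fun δ : ℝ => ε - δ / 2 := by fun_prop
      simpa using (hc.tendsto 0).mono_left nhdsWithin_le_nhds
    refine ((greenRadial_continuousAt κ hε.ne').tendsto.comp h1).congr' ?_
    filter_upwards [self_mem_nhdsWithin, Ioo_mem_nhdsGT (sub_pos.2 h)] with δ hδ hδ'
    rw [Function.comp, smoothMax_of_le_sub hδ (by linarith [hδ'.2])]

/-- For fixed r the expression is eventually constant in δ. The radius r = ε counts as outside,
which matches the complement of the open ball. -/
theorem tendsto_greenRadialDeriv_smoothMax (κ : ℝ) (ε r : ℝ) :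
    Tendsto (fun δ => greenRadialDeriv κ (smoothMax ε δ r) * smoothMaxDeriv ε δ r) (𝓝[>] 0)
      (𝓝 (if ε ≤ r then greenRadialDeriv κ r else 0)) := by
  refine tendsto_const_nhds.congr' ?_
  split_ifs with h
  · filter_upwards [self_mem_nhdsWithin] with δ hδ
    rw [smoothMax_of_le hδ h, smoothMaxDeriv_of_le hδ h]; simp
  · filter_upwards [self_mem_nhdsWithin, Ioo_mem_nhdsGT (sub_pos.2 (not_le.1 h))] with δ hδ hδ'
    rw [smoothMaxDeriv_of_le_sub hδ (by linarith [hδ'.2])]; simp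

theorem norm_greenRadial_le_of_le (κ : ℝ) {a r : ℝ} (ha : 0 < a) (h : a ≤ r) :
    ‖greenRadial κ r‖ ≤ a⁻¹ :=
  (norm_greenRadial_le κ (ha.trans_le h)).trans (inv_anti₀ ha h)

theorem norm_greenRadialDeriv_le_of_le (κ : ℝ) {a r : ℝ} (ha : 0 < a) (h : a ≤ r) :
    ‖greenRadialDeriv κ r‖ ≤ |κ| * a⁻¹ + (a⁻¹) ^ 2 := by
  have hr := ha.trans_le h
  refine (norm_greenRadialDeriv_le κ hr).trans ?_
  have h1 : (|κ| * r + 1) * (r⁻¹) ^ 2 = |κ| * r⁻¹ + (r⁻¹) ^ 2 := by field_simp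
  rw [h1]
  gcongr

/-! ### Integration by parts outside a ball -/

theorem toC3_dotProduct_toC3 (u v : E3) : toC3 u ⬝ᵥ toC3 v = ((⟪u, v⟫ : ℝ) : ℂ) := by
  rw [inner_E3]; simp [toC3, dotProduct, Fin.sum_univ_three]

/-- The factor 3 arises because `C3` carries the supremum norm. -/
theorem norm_toC3_dotProduct_le (u : E3) (F : C3) : ‖toC3 u ⬝ᵥ F‖ ≤ 3 * ‖u‖ * ‖F‖ := by
  have h : ∀ i, ‖toC3 u i * F i‖ ≤ ‖u‖ * ‖F‖ := fun i => by
    rw [norm_mul, toC3, Complex.norm_real]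
    gcongr
    · exact PiLp.norm_apply_le u i
    · exact norm_le_pi_norm F i
  refine (norm_sum_le_of_le _ fun i _ => h i).trans_eq ?_
  simp; ring

theorem continuous_toC3 : Continuous toC3 := by
  unfold toC3; fun_prop

theorem ContinuousOn.aestronglyMeasurable_surfaceMeasure {V : Type*} [NormedAddCommGroup V]
    {Γ : Set E3} (hΓ : IsClosedC2Surface Γ) {f : E3 → V} (hf : ContinuousOn f Γ) :
    AEStronglyMeasurable f (surfaceMeasure Γ) :=
  hf.aestronglyMeasurable_of_isCompact hΓ.isCompact hΓ.isCompact.measurableSet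

/-- Integration by parts on the surface outside a ball: the truncated Green's function
`G(max (|z - y|, ε))` is an admissible test function, so that no boundary terms occur. -/
theorem integral_compl_ball_greenRadialDeriv {Γ : Set E3} (hΓ : IsClosedC2Surface Γ)
    {n : E3 → E3} (hn : IsUnitNormalField Γ n) (κ : ℝ) {F : E3 → C3} {D : E3 → ℂ}
    (hF : IsTangential Γ n F) (hFc : ContinuousOn F Γ) (hDc : ContinuousOn D Γ)
    (hD : HasSurfaceDiv Γ n F D) (w z : E3) {ε : ℝ} (hε : 0 < ε) :
    IntegrableOn (fun y => (toC3 w ⬝ᵥ toC3 (n y)) * (greenRadialDeriv κ (dist z y) / dist z y *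
        (toC3 (y - z) ⬝ᵥ F y))) (Metric.ball z ε)ᶜ (surfaceMeasure Γ) ∧
    ∫ y in (Metric.ball z ε)ᶜ, (toC3 w ⬝ᵥ toC3 (n y)) * (greenRadialDeriv κ (dist z y) / dist z y *
        (toC3 (y - z) ⬝ᵥ F y)) ∂(surfaceMeasure Γ) =
      -∫ y, greenRadial κ (max (dist z y) ε) * ((toC3 w ⬝ᵥ toC3 (n y)) * D y +
        surfGrad Γ n (fun y => toC3 w ⬝ᵥ toC3 (n y)) y ⬝ᵥ F y) ∂(surfaceMeasure Γ) := by
  have hfin := hΓ.isFiniteMeasure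
  -- Test functions must be C¹ on the whole space, so n is replaced by a C¹ extension.
  obtain ⟨N, hN, hNn⟩ := hn.exists_contDiff_extension hΓ
  set a : E3 → ℂ := fun y => toC3 w ⬝ᵥ toC3 (N y) with ha
  have haC : ContDiff ℝ 1 a := by
    simp only [ha, toC3_dotProduct_toC3]
    exact Complex.ofRealCLM.contDiff.comp (contDiff_const.inner ℝ hN)
  set S : E3 → ℂ := fun y => ∑ i, fderiv ℝ a y (EuclideanSpace.single i 1) * F y i with hS
  have hSc : ContinuousOn S Γ := by
    refine continuousOn_finsetSum _ fun i _ => ContinuousOn.mul ?_ ?_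
    · exact ((haC.continuous_fderiv (by norm_num)).clm_apply continuous_const).continuousOn
    · exact (continuous_apply i).comp_continuousOn hFc
  set T : E3 → ℂ := fun y => toC3 (y - z) ⬝ᵥ F y with hT
  have hTc : ContinuousOn T Γ := by
    refine continuousOn_finsetSum _ fun i _ => ContinuousOn.mul ?_ ?_
    · exact ((continuous_apply i).comp
        (continuous_toC3.comp (continuous_id.sub continuous_const))).continuousOn
    · exact (continuous_apply i).comp_continuousOn hFc
  have hae := (ae_surfaceMeasure_mem hΓ).and (ae_surfaceMeasure_ne Γ z)
  obtain ⟨Ca, hCa⟩ := hΓ.isCompact.exists_bound_of_continuousOn haC.continuous.continuousOn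
  obtain ⟨CF, hCF⟩ := hΓ.isCompact.exists_bound_of_continuousOn hFc
  obtain ⟨CD, hCD⟩ := hΓ.isCompact.exists_bound_of_continuousOn hDc
  obtain ⟨CS, hCS⟩ := hΓ.isCompact.exists_bound_of_continuousOn hSc
  have hdm : Measurable fun y : E3 => dist z y := (continuous_const.dist continuous_id).measurable
  have haM : AEStronglyMeasurable a (surfaceMeasure Γ) := haC.continuous.aestronglyMeasurable
  have hDM := hDc.aestronglyMeasurable_surfaceMeasure hΓ
  have hSM := hSc.aestronglyMeasurable_surfaceMeasure hΓ
  have hTM := hTc.aestronglyMeasurable_surfaceMeasure hΓ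
  have hgM : AEStronglyMeasurable (fun y => greenRadial κ (max (dist z y) ε)) (surfaceMeasure Γ) :=
    ((measurable_greenRadial κ).comp (hdm.max measurable_const)).aestronglyMeasurable
  have hgb : ∀ y, ‖greenRadial κ (max (dist z y) ε)‖ ≤ ε⁻¹ := fun y =>
    norm_greenRadial_le_of_le κ hε (le_max_right _ _)
  -- The factor y - z compensates the division by the distance, so the dominating constants below do
  -- not depend on δ.
  have hTb : ∀ y ∈ Γ, y ≠ z → ‖T y‖ / dist z y ≤ 3 * CF := fun y hy hyz => by
    have hd : 0 < dist z y := dist_pos.2 hyz.symm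
    rw [div_le_iff₀ hd]
    refine (norm_toC3_dotProduct_le _ _).trans ?_
    rw [← dist_eq_norm, dist_comm y z]
    have := hCF y hy
    nlinarith
  set P : ℝ → E3 → ℂ := fun δ y => greenRadial κ (smoothMax ε δ (dist z y)) with hP
  set p : ℝ → E3 → ℂ := fun δ y =>
    greenRadialDeriv κ (smoothMax ε δ (dist z y)) * smoothMaxDeriv ε δ (dist z y) with hp
  have hPM : ∀ δ, AEStronglyMeasurable (P δ) (surfaceMeasure Γ) := fun δ =>
    ((measurable_greenRadial κ).comp
      ((contDiff_smoothMax ε δ).continuous.measurable.comp hdm)).aestronglyMeasurable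
  have hpM : ∀ δ, AEStronglyMeasurable (p δ) (surfaceMeasure Γ) := fun δ =>
    (((measurable_greenRadialDeriv κ).comp
      ((contDiff_smoothMax ε δ).continuous.measurable.comp hdm)).mul
      (Complex.measurable_ofReal.comp
        ((continuous_smoothMaxDeriv ε δ).measurable.comp hdm))).aestronglyMeasurable
  have hδ : ∀ᶠ δ : ℝ in 𝓝[>] 0, 0 < δ ∧ δ < ε := Ioo_mem_nhdsGT hε
  have hPb : ∀ δ, 0 < δ ∧ δ < ε → ∀ y, ‖P δ y‖ ≤ (ε / 2)⁻¹ := fun δ hδ y =>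
    norm_greenRadial_le_of_le κ (by positivity)
      ((by linarith [hδ.2] : ε / 2 ≤ ε - δ / 2).trans (le_smoothMax hδ.1 _))
  set Cp : ℝ := |κ| * (ε / 2)⁻¹ + ((ε / 2)⁻¹) ^ 2 with hCp
  have hpb : ∀ δ, 0 < δ ∧ δ < ε → ∀ y, ‖p δ y‖ ≤ Cp := fun δ hδ y => by
    have h1 := norm_greenRadialDeriv_le_of_le κ (a := ε / 2) (by positivity)
      ((by linarith [hδ.2] : ε / 2 ≤ ε - δ / 2).trans (le_smoothMax hδ.1 (dist z y)))
    have h2 := smoothMaxDeriv_mem_Icc (ε := ε) hδ.1 (dist z y)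
    rw [hp, norm_mul, Complex.norm_real, Real.norm_of_nonneg h2.1, ← mul_one Cp]
    exact mul_le_mul h1 h2.2 h2.1 (by positivity)
  -- The weak divergence identity tested with a P_δ; the product rule gives the two terms on the
  -- right. Letting δ → 0 on both sides yields the claim.
  have hparts : ∀ δ, 0 < δ ∧ δ < ε → ∫ y, a y * P δ y * D y ∂(surfaceMeasure Γ) =
      -∫ y, (a y * (p δ y / dist z y * T y) + P δ y * S y) ∂(surfaceMeasure Γ) := fun δ hδ => by
    have hPC := contDiff_greenRadial_smoothMax_dist κ hδ.1 hδ.2 z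
    rw [hD.integral_eq (fun y => a y * P δ y) (haC.mul hPC)]
    congr 1
    refine integral_congr_ae ?_
    filter_upwards [hae] with y hy
    have h1 : HasFDerivAt (P δ) _ y := hasFDerivAt_comp_dist_right hy.2.symm
      (hasDerivAt_greenRadial_smoothMax κ hδ.1 hδ.2 (dist z y))
    have h2 := ((haC.differentiable (by norm_num)) y).hasFDerivAt.mul h1
    have h2' : HasFDerivAt (fun y => a y * P δ y) _ y := h2
    rw [surfGrad_dotProduct hΓ hn hy.1 (φ := fun y => a y * P δ y) h2'.differentiableAt
      (fun _ _ => rfl) (hF y hy.1), h2'.fderiv]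
    simp [hS, hT, hp, Fin.sum_univ_three, dotProduct, toC3, EuclideanSpace.inner_single_right]
    ring
  have hlim1 : Tendsto (fun δ => ∫ y, a y * P δ y * D y ∂(surfaceMeasure Γ)) (𝓝[>] 0)
      (𝓝 (∫ y, a y * greenRadial κ (max (dist z y) ε) * D y ∂(surfaceMeasure Γ))) := by
    refine tendsto_integral_filter_of_dominated_convergence (fun _ => Ca * (ε / 2)⁻¹ * CD)
      (Eventually.of_forall fun δ => (haM.mul (hPM δ)).mul hDM) ?_ (integrable_const _) ?_
    · filter_upwards [hδ] with δ hδ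
      filter_upwards [hae] with y hy
      rw [norm_mul, norm_mul]
      have h0 : 0 ≤ Ca := (norm_nonneg _).trans (hCa y hy.1)
      exact mul_le_mul (mul_le_mul (hCa y hy.1) (hPb δ hδ y) (norm_nonneg _) h0)
        (hCD y hy.1) (norm_nonneg _) (by positivity)
    · refine Eventually.of_forall fun y => ?_
      exact ((tendsto_greenRadial_smoothMax κ hε _).const_mul _).mul_const _
  set W : E3 → ℂ := fun y => a y * (greenRadialDeriv κ (dist z y) / dist z y * T y) with hW
  have hWM : AEStronglyMeasurable W (surfaceMeasure Γ) :=
    haM.mul ((((measurable_greenRadialDeriv κ).comp hdm).div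
      (Complex.measurable_ofReal.comp hdm)).aestronglyMeasurable.mul hTM)
  have hlim2 : Tendsto (fun δ => ∫ y, (a y * (p δ y / dist z y * T y) + P δ y * S y)
        ∂(surfaceMeasure Γ)) (𝓝[>] 0)
      (𝓝 (∫ y, ((Metric.ball z ε)ᶜ.indicator W y + greenRadial κ (max (dist z y) ε) * S y)
        ∂(surfaceMeasure Γ))) := by
    refine tendsto_integral_filter_of_dominated_convergence
      (fun _ => Ca * (Cp * (3 * CF)) + (ε / 2)⁻¹ * CS)
      (Eventually.of_forall fun δ => ?_) ?_ (integrable_const _) ?_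
    · refine (haM.mul (AEStronglyMeasurable.mul ?_ hTM)).add ((hPM δ).mul hSM)
      simp_rw [div_eq_mul_inv]
      exact (hpM δ).mul (Complex.measurable_ofReal.comp hdm).inv.aestronglyMeasurable
    · filter_upwards [hδ] with δ hδ
      filter_upwards [hae] with y hy
      refine norm_add_le_of_le ?_ ?_
      · rw [norm_mul, div_mul_eq_mul_div, mul_div_assoc, norm_mul, norm_div, Complex.norm_real,
          Real.norm_of_nonneg dist_nonneg]
        have h0 : 0 ≤ Ca := (norm_nonneg _).trans (hCa y hy.1)
        have h0' : 0 ≤ Cp := (norm_nonneg _).trans (hpb δ hδ y)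
        exact mul_le_mul (hCa y hy.1) (mul_le_mul (hpb δ hδ y) (hTb y hy.1 hy.2)
          (by positivity) h0') (by positivity) h0
      · rw [norm_mul]
        exact mul_le_mul (hPb δ hδ y) (hCS y hy.1) (norm_nonneg _) (by positivity)
    · refine Eventually.of_forall fun y => ?_
      refine Tendsto.add ?_ ((tendsto_greenRadial_smoothMax κ hε _).mul_const _)
      have h1 := (((tendsto_greenRadialDeriv_smoothMax κ ε (dist z y)).div_const
        (dist z y : ℂ)).mul_const (T y)).const_mul (a y)
      refine h1.trans_eq ?_
      congr 1
      by_cases h : ε ≤ dist z y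
      · have h' : y ∈ (Metric.ball z ε)ᶜ := by simpa [dist_comm] using h
        rw [Set.indicator_of_mem h', if_pos h]
      · have h' : y ∉ (Metric.ball z ε)ᶜ := by simpa [dist_comm] using h
        rw [Set.indicator_of_notMem h', if_neg h]; simp
  have hkey := tendsto_nhds_unique hlim1 (hlim2.neg.congr' (by
    filter_upwards [hδ] with δ hδ using (hparts δ hδ).symm))
  have hms : MeasurableSet (Metric.ball z ε)ᶜ := Metric.isOpen_ball.measurableSet.compl
  have hgS : Integrable (fun y => greenRadial κ (max (dist z y) ε) * S y) (surfaceMeasure Γ) := by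
    refine Integrable.of_bound (hgM.mul hSM) (ε⁻¹ * CS) ?_
    filter_upwards [hae] with y hy
    rw [norm_mul]
    exact mul_le_mul (hgb y) (hCS y hy.1) (norm_nonneg _) (by positivity)
  have hgD : Integrable (fun y => a y * greenRadial κ (max (dist z y) ε) * D y)
      (surfaceMeasure Γ) := by
    refine Integrable.of_bound ((haM.mul hgM).mul hDM) (Ca * ε⁻¹ * CD) ?_
    filter_upwards [hae] with y hy
    rw [norm_mul, norm_mul]
    have h0 : 0 ≤ Ca := (norm_nonneg _).trans (hCa y hy.1)
    exact mul_le_mul (mul_le_mul (hCa y hy.1) (hgb y) (norm_nonneg _) h0)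
      (hCD y hy.1) (norm_nonneg _) (by positivity)
  have hWi : Integrable ((Metric.ball z ε)ᶜ.indicator W) (surfaceMeasure Γ) := by
    refine Integrable.of_bound (hWM.indicator hms)
      (Ca * ((|κ| * ε⁻¹ + (ε⁻¹) ^ 2) * (3 * CF))) ?_
    filter_upwards [hae] with y hy
    have h0 : 0 ≤ Ca := (norm_nonneg _).trans (hCa y hy.1)
    have h0' : 0 ≤ CF := (norm_nonneg _).trans (hCF y hy.1)
    by_cases h : ε ≤ dist z y
    · have h' : y ∈ (Metric.ball z ε)ᶜ := by simpa [dist_comm] using h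
      rw [Set.indicator_of_mem h', hW, norm_mul, div_mul_eq_mul_div, mul_div_assoc, norm_mul,
        norm_div, Complex.norm_real, Real.norm_of_nonneg dist_nonneg]
      exact mul_le_mul (hCa y hy.1) (mul_le_mul (norm_greenRadialDeriv_le_of_le κ hε h)
        (hTb y hy.1 hy.2) (by positivity) (by positivity)) (by positivity) h0
    · have h' : y ∉ (Metric.ball z ε)ᶜ := by simpa [dist_comm] using h
      rw [Set.indicator_of_notMem h', norm_zero]
      positivity
  rw [integral_add hWi hgS, integral_indicator hms] at hkey
  have hleft : (fun y => (toC3 w ⬝ᵥ toC3 (n y)) *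
      (greenRadialDeriv κ (dist z y) / dist z y * (toC3 (y - z) ⬝ᵥ F y)))
      =ᵐ[(surfaceMeasure Γ).restrict (Metric.ball z ε)ᶜ] W := by
    refine ae_restrict_of_ae ?_
    filter_upwards [hae] with y hy
    simp only [hW, ha, hNn y hy.1, hT]
  have hright : ∫ y, greenRadial κ (max (dist z y) ε) * ((toC3 w ⬝ᵥ toC3 (n y)) * D y +
        surfGrad Γ n (fun y => toC3 w ⬝ᵥ toC3 (n y)) y ⬝ᵥ F y) ∂(surfaceMeasure Γ) =
      ∫ y, (a y * greenRadial κ (max (dist z y) ε) * D y +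
        greenRadial κ (max (dist z y) ε) * S y) ∂(surfaceMeasure Γ) := by
    refine integral_congr_ae ?_
    filter_upwards [hae] with y hy
    rw [surfGrad_dotProduct hΓ hn hy.1 (φ := a) (haC.differentiable (by norm_num) y)
      (fun z hz => by simp only [ha, hNn z hz]) (hF y hy.1)]
    simp only [ha, hNn y hy.1, hS]
    ring
  refine ⟨((integrable_indicator_iff hms).1 hWi).congr hleft.symm, ?_⟩
  rw [integral_congr_ae hleft, hright, integral_add hgD hgS, hkey]
  ring

/-- The surface gradient of `w ⬝ n`, tested with a tangential field, is bounded and continuous. -/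
theorem surfGrad_normal_dotProduct {Γ : Set E3} (hΓ : IsClosedC2Surface Γ)
    {n : E3 → E3} (hn : IsUnitNormalField Γ n) {F : E3 → C3} (hF : IsTangential Γ n F)
    (hFc : ContinuousOn F Γ) :
    (∀ w : E3, ContinuousOn
      (fun y => surfGrad Γ n (fun y => toC3 w ⬝ᵥ toC3 (n y)) y ⬝ᵥ F y) Γ) ∧
    ∃ C : ℝ, ∀ w : E3, ‖w‖ ≤ 1 → ∀ y ∈ Γ,
      ‖surfGrad Γ n (fun y => toC3 w ⬝ᵥ toC3 (n y)) y ⬝ᵥ F y‖ ≤ C := by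
  obtain ⟨N, hN, hNn⟩ := hn.exists_contDiff_extension hΓ
  -- Joint continuity in (w, y) gives a bound uniform over the unit ball of w, hence uniform in x
  -- when w = n(x).
  let S : E3 × E3 → ℂ := fun q =>
    ∑ i, ((⟪q.1, fderiv ℝ N q.2 (EuclideanSpace.single i 1)⟫ : ℝ) : ℂ) * F q.2 i
  have hS : ∀ w : E3, ∀ y ∈ Γ,
      surfGrad Γ n (fun y => toC3 w ⬝ᵥ toC3 (n y)) y ⬝ᵥ F y = S (w, y) := fun w y hy => by
    have h1 := ((hasFDerivAt_const w y).inner ℝ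
      (hN.differentiable (by norm_num) y).hasFDerivAt)
    have h2 : HasFDerivAt (fun y => ((⟪w, N y⟫ : ℝ) : ℂ)) _ y :=
      Complex.ofRealCLM.hasFDerivAt.comp y h1
    rw [surfGrad_dotProduct hΓ hn hy h2.differentiableAt
      (fun z hz => by rw [toC3_dotProduct_toC3, hNn z hz]) (hF y hy), h2.fderiv]
    simp [S]
  have hSc : ContinuousOn S (Set.univ ×ˢ Γ) := by
    refine continuousOn_finsetSum _ fun i _ => ContinuousOn.mul ?_ ?_
    · have h1 : Continuous fun q : E3 × E3 => fderiv ℝ N q.2 (EuclideanSpace.single i 1) :=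
        ((hN.continuous_fderiv (by norm_num)).comp continuous_snd).clm_apply continuous_const
      exact (Complex.continuous_ofReal.comp (continuous_fst.inner h1)).continuousOn
    · exact (continuous_apply i).comp_continuousOn
        (hFc.comp continuous_snd.continuousOn fun q hq => hq.2)
  refine ⟨fun w => ?_, ?_⟩
  · refine (hSc.comp (f := fun y => (w, y)) (by fun_prop) fun y hy => ⟨trivial, hy⟩).congr
      fun y hy => hS w y hy
  · obtain ⟨C, hC⟩ := ((isCompact_closedBall (0 : E3) 1).prod hΓ.isCompact).exists_bound_of_continuousOn
      (hSc.mono (Set.prod_mono (Set.subset_univ _) subset_rfl))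
    exact ⟨C, fun w hw y hy => by
      rw [hS w y hy]; exact hC (w, y) ⟨by simpa using hw, hy⟩⟩

/-! ### Limits of the truncated integrals -/

theorem IsUnitNormalField.exists_lipschitz {Γ : Set E3} (hΓ : IsClosedC2Surface Γ)
    {n : E3 → E3} (hn : IsUnitNormalField Γ n) :
    ∃ L : ℝ≥0, ∀ x ∈ Γ, ∀ y ∈ Γ, ‖n x - n y‖ ≤ L * dist x y := by
  obtain ⟨N, hN, hNn⟩ := hn.exists_contDiff_extension hΓ
  obtain ⟨L, hL⟩ := (hN.locallyLipschitz.locallyLipschitzOn (s := Γ)).exists_lipschitzOnWith_of_compact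
    hΓ.isCompact
  refine ⟨L, fun x hx y hy => ?_⟩
  rw [← dist_eq_norm, ← hNn x hx, ← hNn y hy]
  exact hL.dist_le_mul x hx y hy

theorem dotProduct_doubleTerm (κ : ℝ) (n : E3 → E3) (J : E3 → C3) (w : E3) {z y : E3} (h : z ≠ y) :
    toC3 w ⬝ᵥ doubleTerm n κ J z y = ((⟪y - z, n y⟫ : ℝ) : ℂ) *
      (greenRadialDeriv κ (dist z y) / dist z y) * (toC3 w ⬝ᵥ nCross n J y) := by
  rw [doubleTerm, greenNormalDeriv_eq κ n h, dotProduct_smul, smul_eq_mul]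

theorem norm_greenRadialDeriv_div_le (κ : ℝ) {r : ℝ} (hr : 0 < r) (t : ℝ) (ht : |t| ≤ r) :
    ‖((t : ℝ) : ℂ) * (greenRadialDeriv κ r / r)‖ ≤ |κ| * r⁻¹ + (r⁻¹) ^ 2 := by
  rw [norm_mul, norm_div, Complex.norm_real, Complex.norm_real, Real.norm_of_nonneg hr.le,
    Real.norm_eq_abs, ← mul_div_assoc, div_le_iff₀ hr, mul_comm]
  exact mul_le_mul (norm_greenRadialDeriv_le_of_le κ hr le_rfl) ht (abs_nonneg _) (by positivity)

theorem measurable_dist_right (z : E3) : Measurable fun y : E3 => dist z y :=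
  (continuous_const.dist continuous_id).measurable

theorem aestronglyMeasurable_green (Γ : Set E3) (κ : ℝ) (z : E3) :
    AEStronglyMeasurable (fun y => green κ z y) (surfaceMeasure Γ) :=
  ((measurable_greenRadial κ).comp (measurable_dist_right z)).aestronglyMeasurable

theorem aestronglyMeasurable_doubleTerm {Γ : Set E3} (hΓ : IsClosedC2Surface Γ)
    {n : E3 → E3} (hn : IsUnitNormalField Γ n) (κ : ℝ) {J : E3 → C3}
    (hFc : ContinuousOn (nCross n J) Γ) (z : E3) :
    AEStronglyMeasurable (fun y => doubleTerm n κ J z y) (surfaceMeasure Γ) := by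
  have h1 : AEStronglyMeasurable (fun y => ((⟪y - z, n y⟫ : ℝ) : ℂ)) (surfaceMeasure Γ) := by
    refine ContinuousOn.aestronglyMeasurable_surfaceMeasure hΓ ?_
    exact Complex.continuous_ofReal.comp_continuousOn
      ((continuous_id.sub continuous_const).continuousOn.inner hn.continuousOn)
  have h2 : AEStronglyMeasurable (fun y => greenRadialDeriv κ (dist z y) / dist z y)
      (surfaceMeasure Γ) :=
    (((measurable_greenRadialDeriv κ).comp (measurable_dist_right z)).div
      (Complex.measurable_ofReal.comp (measurable_dist_right z))).aestronglyMeasurable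
  refine ((h1.mul h2).smul (hFc.aestronglyMeasurable_surfaceMeasure hΓ)).congr ?_
  filter_upwards [ae_surfaceMeasure_ne Γ z] with y hy
  simp only [Pi.smul_apply', Pi.mul_apply]
  rw [doubleTerm, greenNormalDeriv_eq κ n hy.symm]

/-- Dot product with a fixed vector, as a continuous linear functional. -/
def dotCLM (w : C3) : C3 →L[ℂ] ℂ := ∑ i, w i • ContinuousLinearMap.proj i

theorem dotCLM_apply (w F : C3) : dotCLM w F = w ⬝ᵥ F := by
  simp [dotCLM, dotProduct]

/-- The limit of the truncated integrals, along points and truncation radii which approach a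
point of the surface nontangentially. -/
theorem tendsto_integral_compl_ball_curl {Γ : Set E3} (hΓ : IsClosedC2Surface Γ)
    {n : E3 → E3} (hn : IsUnitNormalField Γ n) (κ : ℝ) {J : E3 → C3} {D : E3 → ℂ}
    (hJ : IsTangential Γ n J)
    (hF : IsTangential Γ n (nCross n J)) (hFc : ContinuousOn (nCross n J) Γ)
    (hDc : ContinuousOn D Γ) (hD : HasSurfaceDiv Γ n (nCross n J) D) {x : E3} (hx : x ∈ Γ)
    (hdbl : Integrable (fun y => doubleTerm n κ J x y) (surfaceMeasure Γ))
    {ι : Type*} {l : Filter ι} [l.IsCountablyGenerated] {z : ι → E3} {ε : ι → ℝ}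
    (hz : Tendsto z l (𝓝 x)) (hε : Tendsto ε l (𝓝 0)) (hε0 : ∀ᶠ i in l, 0 < ε i)
    (hxz : ∀ᶠ i in l, ∀ y ∈ Γ, dist x y ≤ 2 * dist (z i) y) :
    Tendsto (fun i => ∫ y in (Metric.ball (z i) (ε i))ᶜ,
        toC3 (n x) ⬝ᵥ curl (fun z => green κ z y • J y) (z i) ∂(surfaceMeasure Γ)) l
      (𝓝 (-(∫ y, green κ x y * ((toC3 (n x) ⬝ᵥ toC3 (n y)) * D y +
          surfGrad Γ n (fun y => toC3 (n x) ⬝ᵥ toC3 (n y)) y ⬝ᵥ nCross n J y)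
            ∂(surfaceMeasure Γ))
        - toC3 (n x) ⬝ᵥ (∫ y, doubleTerm n κ J x y ∂(surfaceMeasure Γ)))) := by
  have hfin := hΓ.isFiniteMeasure
  have hdint := hΓ.integrable_inv_dist hx
  set Q : E3 → ℂ := fun y => (toC3 (n x) ⬝ᵥ toC3 (n y)) * D y +
    surfGrad Γ n (fun y => toC3 (n x) ⬝ᵥ toC3 (n y)) y ⬝ᵥ nCross n J y with hQ
  have hQc : ContinuousOn Q Γ := by
    refine ContinuousOn.add (ContinuousOn.mul ?_ hDc)
      ((surfGrad_normal_dotProduct hΓ hn hF hFc).1 (n x))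
    simp_rw [toC3_dotProduct_toC3]
    exact Complex.continuous_ofReal.comp_continuousOn (continuousOn_const.inner hn.continuousOn)
  obtain ⟨CQ, hCQ⟩ := hΓ.isCompact.exists_bound_of_continuousOn hQc
  obtain ⟨CF, hCF⟩ := hΓ.isCompact.exists_bound_of_continuousOn hFc
  obtain ⟨L, hL⟩ := hn.exists_lipschitz hΓ
  have hCF0 : 0 ≤ CF := (norm_nonneg _).trans (hCF x hx)
  have hms : ∀ i, MeasurableSet (Metric.ball (z i) (ε i))ᶜ := fun i =>
    Metric.isOpen_ball.measurableSet.compl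
  have hae := (ae_surfaceMeasure_mem hΓ).and (ae_surfaceMeasure_ne Γ x)
  set V : E3 → E3 → ℂ := fun z y => toC3 (n x) ⬝ᵥ doubleTerm n κ J z y with hV
  have hVM : ∀ z, AEStronglyMeasurable (V z) (surfaceMeasure Γ) := fun z => by
    have := (dotCLM (toC3 (n x))).continuous.comp_aestronglyMeasurable
      (aestronglyMeasurable_doubleTerm hΓ hn κ hFc z)
    exact this.congr (Eventually.of_forall fun y => dotCLM_apply _ _)
  have hpos : ∀ {a : E3}, (∀ y ∈ Γ, dist x y ≤ 2 * dist a y) → ∀ y ∈ Γ, y ≠ x →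
      0 < dist a y ∧ (dist a y)⁻¹ ≤ 2 * (dist x y)⁻¹ := fun {a} ha y hy hyx => by
    have h0 : 0 < dist x y := dist_pos.2 hyx.symm
    have h1 := ha y hy
    refine ⟨by linarith, ?_⟩
    rw [← inv_inv (2 : ℝ), ← mul_inv]
    exact inv_anti₀ (by positivity) (by linarith)
  -- The product of 3 L |x - y| CF, from the tangentiality of F, and |κ| (2/|x - y|) + (2/|x - y|)²,
  -- from the kernel at a point a with |x - y| ≤ 2|a - y|.
  set bnd : E3 → ℝ := fun y => (3 * L * CF) * (2 * |κ| + 4 * (dist x y)⁻¹) with hbnd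
  have hbint : Integrable bnd (surfaceMeasure Γ) :=
    ((integrable_const _).add (hdint.const_mul 4)).const_mul _
  have hVb : ∀ {a : E3}, (∀ y ∈ Γ, dist x y ≤ 2 * dist a y) → ∀ y ∈ Γ, y ≠ x →
      ‖V a y‖ ≤ bnd y := fun {a} ha y hy hyx => by
    obtain ⟨h0, h1⟩ := hpos ha y hy hyx
    have hd : 0 < dist x y := dist_pos.2 hyx.symm
    rw [hV]
    simp only
    rw [dotProduct_doubleTerm κ n J _ (dist_pos.1 h0), norm_mul]
    have h2 : ‖toC3 (n x) ⬝ᵥ nCross n J y‖ ≤ 3 * (L * dist x y) * CF := by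
      have h3 : toC3 (n x) ⬝ᵥ nCross n J y = toC3 (n x - n y) ⬝ᵥ nCross n J y := by
        have h4 : toC3 (n x - n y) = toC3 (n x) - toC3 (n y) := by
          ext i; simp [toC3]
        rw [h4, sub_dotProduct, hF y hy, sub_zero]
      rw [h3]
      refine (norm_toC3_dotProduct_le _ _).trans ?_
      gcongr
      · exact hL x hx y hy
      · exact hCF y hy
    -- Only Cauchy–Schwarz is used for (y - a) · n(y), since a may lie off Γ where the quadratic
    -- chord estimate is unavailable.
    have h3 := norm_greenRadialDeriv_div_le κ h0 ⟪y - a, n y⟫ (by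
      have := abs_real_inner_le_norm (y - a) (n y)
      rwa [hn.norm_eq_one y hy, mul_one, ← dist_eq_norm, dist_comm] at this)
    have h4 : |κ| * (dist a y)⁻¹ + ((dist a y)⁻¹) ^ 2 ≤
        |κ| * (2 * (dist x y)⁻¹) + (2 * (dist x y)⁻¹) ^ 2 := by gcongr
    refine (mul_le_mul (h3.trans h4) h2 (norm_nonneg _) (by positivity)).trans_eq ?_
    rw [hbnd]; field_simp; ring
  have hlimV : Tendsto (fun i => ∫ y, (Metric.ball (z i) (ε i))ᶜ.indicator (V (z i)) y
      ∂(surfaceMeasure Γ)) l (𝓝 (∫ y, V x y ∂(surfaceMeasure Γ))) := by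
    refine tendsto_integral_filter_of_dominated_convergence bnd
      (Eventually.of_forall fun i => (hVM (z i)).indicator (hms i)) ?_ hbint ?_
    · filter_upwards [hxz] with i hi
      filter_upwards [hae] with y hy
      exact (norm_indicator_le_norm_self _ _).trans (hVb hi y hy.1 hy.2)
    · filter_upwards [hae] with y hy
      have hd : 0 < dist x y := dist_pos.2 hy.2.symm
      have hdl : Tendsto (fun i => dist (z i) y) l (𝓝 (dist x y)) := hz.dist tendsto_const_nhds
      have h1 : ∀ᶠ i in l, ε i < dist (z i) y :=
        hε.eventually_lt hdl hd
      have hlim : Tendsto (fun i => ((⟪y - z i, n y⟫ : ℝ) : ℂ) *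
          (greenRadialDeriv κ (dist (z i) y) / dist (z i) y) * (toC3 (n x) ⬝ᵥ nCross n J y)) l
          (𝓝 (V x y)) := by
        rw [hV]
        simp only
        rw [dotProduct_doubleTerm κ n J _ hy.2.symm]
        refine Tendsto.mul_const _ (Tendsto.mul ?_ (Tendsto.div ?_ ?_ ?_))
        · exact (Complex.continuous_ofReal.tendsto _).comp
            ((tendsto_const_nhds.sub hz).inner tendsto_const_nhds)
        · exact (greenRadialDeriv_continuousAt κ hd.ne').tendsto.comp hdl
        · exact (Complex.continuous_ofReal.tendsto _).comp hdl
        · exact_mod_cast hd.ne'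
      refine hlim.congr' ?_
      filter_upwards [h1, hdl.eventually (lt_mem_nhds hd)] with i hi hi'
      have h' : y ∈ (Metric.ball (z i) (ε i))ᶜ := by simpa [dist_comm] using hi.le
      rw [Set.indicator_of_mem h']
      exact (dotProduct_doubleTerm κ n J _ (dist_pos.1 hi')).symm
  have hlimQ : Tendsto (fun i => ∫ y, greenRadial κ (max (dist (z i) y) (ε i)) * Q y
      ∂(surfaceMeasure Γ)) l (𝓝 (∫ y, green κ x y * Q y ∂(surfaceMeasure Γ))) := by
    refine tendsto_integral_filter_of_dominated_convergence (fun y => 2 * (dist x y)⁻¹ * CQ)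
      (Eventually.of_forall fun i => ?_) ?_ ((hdint.const_mul 2).mul_const _) ?_
    · exact ((measurable_greenRadial κ).comp ((measurable_dist_right _).max
        measurable_const)).aestronglyMeasurable.mul (hQc.aestronglyMeasurable_surfaceMeasure hΓ)
    · filter_upwards [hxz] with i hi
      filter_upwards [hae] with y hy
      obtain ⟨h0, h1⟩ := hpos hi y hy.1 hy.2
      rw [norm_mul]
      exact mul_le_mul ((norm_greenRadial_le_of_le κ h0 (le_max_left _ _)).trans h1)
        (hCQ y hy.1) (norm_nonneg _) (by positivity)
    · filter_upwards [hae] with y hy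
      have hd : 0 < dist x y := dist_pos.2 hy.2.symm
      have hdl : Tendsto (fun i => dist (z i) y) l (𝓝 (dist x y)) := hz.dist tendsto_const_nhds
      have hml : Tendsto (fun i => max (dist (z i) y) (ε i)) l (𝓝 (dist x y)) := by
        simpa [hd.le] using hdl.max hε
      exact ((greenRadial_continuousAt κ hd.ne').tendsto.comp hml).mul_const _
  have heq : ∀ᶠ i in l, ∫ y in (Metric.ball (z i) (ε i))ᶜ,
        toC3 (n x) ⬝ᵥ curl (fun z => green κ z y • J y) (z i) ∂(surfaceMeasure Γ) =
      -(∫ y, greenRadial κ (max (dist (z i) y) (ε i)) * Q y ∂(surfaceMeasure Γ)) -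
        ∫ y, (Metric.ball (z i) (ε i))ᶜ.indicator (V (z i)) y ∂(surfaceMeasure Γ) := by
    filter_upwards [hε0, hxz] with i hi hi'
    obtain ⟨hint, hval⟩ := integral_compl_ball_greenRadialDeriv hΓ hn κ hF hFc hDc hD (n x) (z i) hi
    have hVi : IntegrableOn (V (z i)) (Metric.ball (z i) (ε i))ᶜ (surfaceMeasure Γ) := by
      refine (hbint.mono' (hVM _) ?_).integrableOn
      filter_upwards [hae] with y hy using hVb hi' y hy.1 hy.2
    rw [← hval, integral_indicator (hms i), ← integral_sub hint hVi]
    refine integral_congr_ae ?_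
    filter_upwards [ae_restrict_of_ae (ae_surfaceMeasure_mem hΓ), ae_restrict_mem (hms i)]
      with y hy hyb
    have hzy : z i ≠ y := by
      rintro h; rw [h] at hyb; exact hyb (Metric.mem_ball_self hi)
    rw [dotProduct_curl_green_smul κ (n x) hzy (hn.norm_eq_one y hy) (hJ y hy)]
    simp only [hV]
    ring
  have hfinal : ∫ y, V x y ∂(surfaceMeasure Γ) =
      toC3 (n x) ⬝ᵥ ∫ y, doubleTerm n κ J x y ∂(surfaceMeasure Γ) := by
    rw [← dotCLM_apply, ← ContinuousLinearMap.integral_comp_comm _ hdbl]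
    simp_rw [dotCLM_apply]
    rfl
  rw [← hfinal]
  exact (hlimQ.neg.sub hlimV).congr' (by filter_upwards [heq] with i hi using hi.symm)

/-- J is recovered as (n × J) × n, so it inherits continuity from n × J and n. -/
theorem continuousOn_of_continuousOn_nCross {Γ : Set E3} {n : E3 → E3}
    (hn : IsUnitNormalField Γ n) {J : E3 → C3} (hJ : IsTangential Γ n J)
    (hFc : ContinuousOn (nCross n J) Γ) : ContinuousOn J Γ := by
  have hnc : ∀ i, ContinuousOn (fun y => (n y i : ℂ)) Γ := fun i =>
    Complex.continuous_ofReal.comp_continuousOn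
      ((EuclideanSpace.proj (𝕜 := ℝ) i).continuous.comp_continuousOn hn.continuousOn)
  have hFi : ∀ i, ContinuousOn (fun y => nCross n J y i) Γ := fun i =>
    (continuous_apply i).comp_continuousOn hFc
  have hJF : ∀ y ∈ Γ, nCross n J y ⨯₃ toC3 (n y) = J y := fun y hy => by
    have hnn : (n y 0 : ℂ) ^ 2 + (n y 1 : ℂ) ^ 2 + (n y 2 : ℂ) ^ 2 = 1 := by
      have h1 := toC3_dotProduct_toC3 (n y) (n y)
      rw [real_inner_self_eq_norm_sq, hn.norm_eq_one y hy] at h1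
      simp [toC3, dotProduct, Fin.sum_univ_three] at h1
      linear_combination h1
    have h := hJ y hy
    simp only [dotProduct, Fin.sum_univ_three, toC3] at h
    ext i
    fin_cases i
    · simp [nCross, toC3, cross_apply]
      linear_combination (J y 0) * hnn - (n y 0 : ℂ) * h
    · simp [nCross, toC3, cross_apply]
      linear_combination (J y 1) * hnn - (n y 1 : ℂ) * h
    · simp [nCross, toC3, cross_apply]
      linear_combination (J y 2) * hnn - (n y 2 : ℂ) * h
  refine ContinuousOn.congr ?_ fun y hy => (hJF y hy).symm
  rw [continuousOn_pi]
  intro i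
  fin_cases i
  · simp only [cross_apply, toC3]
    exact ((hFi 1).mul (hnc 2)).sub ((hFi 2).mul (hnc 1))
  · simp only [cross_apply, toC3]
    exact ((hFi 2).mul (hnc 0)).sub ((hFi 0).mul (hnc 2))
  · simp only [cross_apply, toC3]
    exact ((hFi 0).mul (hnc 1)).sub ((hFi 1).mul (hnc 0))

/-! ### The single layer potential off the surface -/

/-- Off the surface the single layer potential may be differentiated under the integral sign. -/
theorem dotProduct_curl_singleLayer {Γ : Set E3} (hΓ : IsClosedC2Surface Γ) (κ : ℝ)
    {J : E3 → C3} (hJc : ContinuousOn J Γ) (v : C3) {z : E3} {d : ℝ} (hd : 0 < d)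
    (hz : ∀ y ∈ Γ, d ≤ dist z y) :
    v ⬝ᵥ curl (singleLayer Γ κ J) z =
      ∫ y, v ⬝ᵥ curl (fun z => green κ z y • J y) z ∂(surfaceMeasure Γ) := by
  have hfin := hΓ.isFiniteMeasure
  obtain ⟨CJ, hCJ⟩ := hΓ.isCompact.exists_bound_of_continuousOn hJc
  have hmem := ae_surfaceMeasure_mem hΓ
  have hJM := hJc.aestronglyMeasurable_surfaceMeasure hΓ
  let A : E3 → E3 → E3 →L[ℝ] C3 := fun z y =>
    (innerSL ℝ (z - y)).smulRight ((greenRadialDeriv κ (dist z y) / dist z y) • J y)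
  have hA : ∀ {z y : E3}, z ≠ y → HasFDerivAt (fun z => green κ z y • J y) (A z y) z :=
    fun {z y} h => (hasFDerivAt_green_smul κ (J y) h).congr_fderiv (by
      ext u i
      simp [A, mul_assoc])
  -- On the ball of radius d/2 about z all points keep distance at least d/2 from Γ, which bounds
  -- the derivative of the integrand uniformly.
  have hfar : ∀ a ∈ Metric.ball z (d / 2), ∀ y ∈ Γ, d / 2 ≤ dist a y := fun a ha y hy => by
    have h1 := hz y hy
    have h2 := dist_triangle z a y
    rw [dist_comm z a] at h2
    have h3 := Metric.mem_ball.1 ha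
    linarith
  have hcont : ContinuousOn (fun y => A z y) Γ := by
    have hk : ContinuousOn (fun y => greenRadialDeriv κ (dist z y) / (dist z y : ℂ)) Γ := by
      intro y hy
      have h0 : dist z y ≠ 0 := by have := hz y hy; linarith
      have hc : ContinuousAt (fun y : E3 => dist z y) y := by fun_prop
      refine ContinuousAt.continuousWithinAt (ContinuousAt.div ?_ ?_ ?_)
      · exact (greenRadialDeriv_continuousAt κ h0).comp (f := fun y : E3 => dist z y) hc
      · exact Complex.continuous_ofReal.continuousAt.comp hc
      · exact_mod_cast h0
    have h1 : ContinuousOn (fun y => (greenRadialDeriv κ (dist z y) / dist z y) • J y) Γ :=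
      hk.smul hJc
    have h2 : Continuous fun y : E3 => innerSL ℝ (z - y) := by fun_prop
    exact (((ContinuousLinearMap.smulRightL ℝ E3 C3).continuous.comp h2).continuousOn).clm_apply h1
  have hGi : Integrable (fun y => green κ z y • J y) (surfaceMeasure Γ) := by
    refine Integrable.of_bound ((aestronglyMeasurable_green Γ κ z).smul hJM) (d⁻¹ * CJ) ?_
    filter_upwards [hmem] with y hy
    rw [norm_smul]
    exact mul_le_mul (norm_greenRadial_le_of_le κ hd (hz y hy)) (hCJ y hy) (norm_nonneg _)
      (by positivity)
  have hder : HasFDerivAt (singleLayer Γ κ J) (∫ y, A z y ∂(surfaceMeasure Γ)) z := by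
    refine hasFDerivAt_integral_of_dominated_of_fderiv_le
      (F := fun z y => green κ z y • J y) (F' := A)
      (bound := fun _ => (|κ| * (d / 2)⁻¹ + ((d / 2)⁻¹) ^ 2) * CJ)
      (Metric.ball_mem_nhds z (half_pos hd))
      (Eventually.of_forall fun a => (aestronglyMeasurable_green Γ κ a).smul hJM) hGi
      (hcont.aestronglyMeasurable_surfaceMeasure hΓ) ?_ (integrable_const _) ?_
    · filter_upwards [hmem] with y hy a ha
      have h1 := hfar a ha y hy
      have h0 : 0 < dist a y := (half_pos hd).trans_le h1
      have h2 : ‖A a y‖ = ‖greenRadialDeriv κ (dist a y)‖ * ‖J y‖ := by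
        simp only [A]
        rw [ContinuousLinearMap.norm_smulRight_apply, innerSL_apply_norm, norm_smul, norm_div,
          Complex.norm_real, Real.norm_of_nonneg h0.le, ← dist_eq_norm]
        field_simp
      rw [h2]
      exact mul_le_mul (norm_greenRadialDeriv_le_of_le κ (half_pos hd) h1) (hCJ y hy)
        (norm_nonneg _) (by positivity)
    · filter_upwards [hmem] with y hy a ha
      have h0 : 0 < dist a y := (half_pos hd).trans_le (hfar a ha y hy)
      exact hA (dist_pos.1 h0)
  have hAi : Integrable (fun y => A z y) (surfaceMeasure Γ) := by
    obtain ⟨C, hC⟩ := hΓ.isCompact.exists_bound_of_continuousOn hcont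
    refine Integrable.of_bound (hcont.aestronglyMeasurable_surfaceMeasure hΓ) C ?_
    filter_upwards [hmem] with y hy using hC y hy
  rw [dotProduct_curl, hder.fderiv, ← ContinuousLinearMap.integral_comp_comm _ hAi]
  refine integral_congr_ae ?_
  filter_upwards [hmem] with y hy
  have h0 : 0 < dist z y := hd.trans_le (hz y hy)
  rw [dotProduct_curl, (hA (dist_pos.1 h0)).fderiv]

/-! ### Weak singularity of the three integrands and conclusion -/

theorem surfaceDiv_spec {Γ : Set E3} {n : E3 → E3} {F : E3 → C3}
    (h : ∃ D : E3 → ℂ, ContinuousOn D Γ ∧ HasSurfaceDiv Γ n F D) :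
    ContinuousOn (surfaceDiv Γ n F) Γ ∧ HasSurfaceDiv Γ n F (surfaceDiv Γ n F) := by
  rw [surfaceDiv, dif_pos h]
  exact h.choose_spec

theorem continuousOn_of_mem_HolderSpace {V : Type} [NormedAddCommGroup V] {Γ : Set E3} {α : ℝ≥0}
    (hα : 0 < α) {f : E3 → V} (hf : f ∈ HolderSpace Γ α) : ContinuousOn f Γ := by
  obtain ⟨C, hC⟩ := hf
  exact hC.continuousOn hα

theorem norm_green_le (κ : ℝ) {x y : E3} (h : x ≠ y) : ‖green κ x y‖ ≤ (dist x y)⁻¹ :=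
  norm_greenRadial_le κ (dist_pos.2 h)

theorem exists_norm_gradTerm_le {Γ : Set E3} (hΓ : IsClosedC2Surface Γ) {n : E3 → E3}
    (hn : IsUnitNormalField Γ n) (κ : ℝ) {J : E3 → C3} (hF : IsTangential Γ n (nCross n J))
    (hFc : ContinuousOn (nCross n J) Γ) :
    ∃ C : ℝ, ∀ x ∈ Γ, ∀ y ∈ Γ, x ≠ y → ‖gradTerm Γ n κ J x y‖ ≤ C / dist x y := by
  obtain ⟨C, hC⟩ := (surfGrad_normal_dotProduct hΓ hn hF hFc).2
  refine ⟨C, fun x hx y hy hxy => ?_⟩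
  rw [gradTerm, norm_mul, div_eq_inv_mul]
  exact mul_le_mul (norm_green_le κ hxy) (hC _ (hn.norm_eq_one x hx).le y hy) (norm_nonneg _)
    (by positivity)

theorem exists_norm_divTerm_le {Γ : Set E3} (hΓ : IsClosedC2Surface Γ) {n : E3 → E3}
    (hn : IsUnitNormalField Γ n) (κ : ℝ) {J : E3 → C3}
    (hDc : ContinuousOn (surfaceDiv Γ n (nCross n J)) Γ) :
    ∃ C : ℝ, ∀ x ∈ Γ, ∀ y ∈ Γ, x ≠ y → ‖divTerm Γ n κ J x y‖ ≤ C / dist x y := by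
  obtain ⟨C, hC⟩ := hΓ.isCompact.exists_bound_of_continuousOn hDc
  refine ⟨C, fun x hx y hy hxy => ?_⟩
  have h1 : ‖toC3 (n x) ⬝ᵥ toC3 (n y)‖ ≤ 1 := by
    rw [toC3_dotProduct_toC3, Complex.norm_real, Real.norm_eq_abs]
    simpa [hn.norm_eq_one x hx, hn.norm_eq_one y hy] using abs_real_inner_le_norm (n x) (n y)
  rw [divTerm, norm_mul, norm_mul, div_eq_inv_mul, ← mul_one (dist x y)⁻¹]
  exact mul_le_mul (mul_le_mul (norm_green_le κ hxy) h1 (norm_nonneg _) (by positivity))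
    (hC y hy) (norm_nonneg _) (by positivity)

/-- The chord estimate supplies |x - y|² against a kernel of order |x - y|⁻³; the diameter of Γ
absorbs the lower order term with κ. -/
theorem exists_norm_doubleTerm_le {Γ : Set E3} (hΓ : IsClosedC2Surface Γ) {n : E3 → E3}
    (hn : IsUnitNormalField Γ n) (κ : ℝ) {J : E3 → C3} (hFc : ContinuousOn (nCross n J) Γ) :
    ∃ C : ℝ, ∀ x ∈ Γ, ∀ y ∈ Γ, x ≠ y → ‖doubleTerm n κ J x y‖ ≤ C / dist x y := by
  obtain ⟨CF, hCF⟩ := hΓ.isCompact.exists_bound_of_continuousOn hFc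
  obtain ⟨C, hC0, hC⟩ := hn.exists_abs_inner_le hΓ
  refine ⟨C * (|κ| * Metric.diam Γ + 1) * CF, fun x hx y hy hxy => ?_⟩
  have hd : 0 < dist x y := dist_pos.2 hxy
  have hdiam : dist x y ≤ Metric.diam Γ := Metric.dist_le_diam_of_mem hΓ.isCompact.isBounded hx hy
  rw [doubleTerm, greenNormalDeriv_eq κ n hxy, norm_smul, norm_mul, norm_div, Complex.norm_real,
    Complex.norm_real, Real.norm_of_nonneg hd.le, Real.norm_eq_abs, mul_div_right_comm]
  have h1 : |⟪y - x, n y⟫| ≤ C * dist x y ^ 2 := by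
    rw [real_inner_comm, ← neg_sub x y, inner_neg_right, abs_neg]; exact hC x hx y hy
  have h2 : ‖greenRadialDeriv κ (dist x y)‖ ≤ (|κ| * Metric.diam Γ + 1) * (dist x y)⁻¹ ^ 2 := by
    refine (norm_greenRadialDeriv_le κ hd).trans ?_
    gcongr
  refine mul_le_mul ?_ (hCF y hy) (norm_nonneg _)
    (div_nonneg (mul_nonneg hC0.le (by positivity)) hd.le)
  rw [mul_div_assoc']
  gcongr ?_ / _
  calc |⟪y - x, n y⟫| * ‖greenRadialDeriv κ (dist x y)‖
      ≤ (C * dist x y ^ 2) * ((|κ| * Metric.diam Γ + 1) * (dist x y)⁻¹ ^ 2) := by gcongr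
    _ = C * (|κ| * Metric.diam Γ + 1) := by field_simp

theorem integrable_of_norm_le_div_dist {V : Type*} [NormedAddCommGroup V] {Γ : Set E3}
    (hΓ : IsClosedC2Surface Γ) {x : E3} (hx : x ∈ Γ) {f : E3 → V}
    (hf : AEStronglyMeasurable f (surfaceMeasure Γ)) {C : ℝ}
    (hC : ∀ y ∈ Γ, x ≠ y → ‖f y‖ ≤ C / dist x y) : Integrable f (surfaceMeasure Γ) := by
  refine ((hΓ.integrable_inv_dist hx).const_mul C).mono' hf ?_
  filter_upwards [ae_surfaceMeasure_mem hΓ, ae_surfaceMeasure_ne Γ x] with y hy hyx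
  exact hC y hy hyx.symm

end

theorem theorem2 (Γ : Set E3) (hΓ : IsClosedC2Surface Γ)
    (n : E3 → E3) (hn : IsUnitNormalField Γ n)
    (κ : ℝ) (α : ℝ≥0) (hα₀ : 0 < α) (hα₁ : α < 1)
    (J : E3 → C3) (hJ : IsTangential Γ n J) (hnJ : nCross n J ∈ TdSpace Γ n α) :
    -- the integrands on the right-hand side are weakly singular, uniformly on `Γ`
    (∃ C : ℝ, ∀ x ∈ Γ, ∀ y ∈ Γ, x ≠ y →
      ‖gradTerm Γ n κ J x y‖ ≤ C / dist x y ∧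
      ‖divTerm Γ n κ J x y‖ ≤ C / dist x y ∧
      ‖doubleTerm n κ J x y‖ ≤ C / dist x y) ∧
    ∀ x ∈ Γ,
      Integrable (fun y => gradTerm Γ n κ J x y) (surfaceMeasure Γ) ∧
      Integrable (fun y => divTerm Γ n κ J x y) (surfaceMeasure Γ) ∧
      Integrable (fun y => doubleTerm n κ J x y) (surfaceMeasure Γ) ∧
      -- the left-hand side as a Cauchy principal value on `Γ`
      Tendsto (fun ε : ℝ => ∫ y in (Metric.ball x ε)ᶜ,
          toC3 (n x) ⬝ᵥ curl (fun z => green κ z y • J y) x ∂(surfaceMeasure Γ))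
        (𝓝[>] 0)
        (𝓝 (-(∫ y, gradTerm Γ n κ J x y ∂(surfaceMeasure Γ))
          - (∫ y, divTerm Γ n κ J x y ∂(surfaceMeasure Γ))
          - toC3 (n x) ⬝ᵥ (∫ y, doubleTerm n κ J x y ∂(surfaceMeasure Γ)))) ∧
      -- the left-hand side as the boundary value of `n ⬝ ∇ × S J`, from either side of `Γ`
      Tendsto (fun h : ℝ => toC3 (n x) ⬝ᵥ curl (singleLayer Γ κ J) (x + h • n x))
        (𝓝[≠] 0)
        (𝓝 (-(∫ y, gradTerm Γ n κ J x y ∂(surfaceMeasure Γ))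
          - (∫ y, divTerm Γ n κ J x y ∂(surfaceMeasure Γ))
          - toC3 (n x) ⬝ᵥ (∫ y, doubleTerm n κ J x y ∂(surfaceMeasure Γ)))) := by
  obtain ⟨hF, hFh, D₀, hD₀, hD₀div⟩ := hnJ
  have hFc := continuousOn_of_mem_HolderSpace hα₀ hFh
  obtain ⟨hDc, hD⟩ := surfaceDiv_spec ⟨D₀, continuousOn_of_mem_HolderSpace hα₀ hD₀, hD₀div⟩
  have hJc := continuousOn_of_continuousOn_nCross hn hJ hFc
  obtain ⟨C₁, h₁⟩ := exists_norm_gradTerm_le hΓ hn κ hF hFc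
  obtain ⟨C₂, h₂⟩ := exists_norm_divTerm_le hΓ hn κ hDc
  obtain ⟨C₃, h₃⟩ := exists_norm_doubleTerm_le hΓ hn κ hFc
  refine ⟨⟨max C₁ (max C₂ C₃), fun x hx y hy hxy => ⟨(h₁ x hx y hy hxy).trans ?_,
    (h₂ x hx y hy hxy).trans ?_, (h₃ x hx y hy hxy).trans ?_⟩⟩, fun x hx => ?_⟩
  · gcongr; exact le_max_left _ _
  · gcongr; exact (le_max_left _ _).trans (le_max_right _ _)
  · gcongr; exact (le_max_right _ _).trans (le_max_right _ _)
  have hgrad : Integrable (fun y => gradTerm Γ n κ J x y) (surfaceMeasure Γ) :=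
    integrable_of_norm_le_div_dist hΓ hx ((aestronglyMeasurable_green Γ κ x).mul
      (((surfGrad_normal_dotProduct hΓ hn hF hFc).1
        (n x)).aestronglyMeasurable_surfaceMeasure hΓ)) (h₁ x hx)
  have hdiv : Integrable (fun y => divTerm Γ n κ J x y) (surfaceMeasure Γ) := by
    have hc : ContinuousOn (fun y => toC3 (n x) ⬝ᵥ toC3 (n y)) Γ := by
      simp_rw [toC3_dotProduct_toC3]
      exact Complex.continuous_ofReal.comp_continuousOn (continuousOn_const.inner hn.continuousOn)
    exact integrable_of_norm_le_div_dist hΓ hx (((aestronglyMeasurable_green Γ κ x).mul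
      (hc.aestronglyMeasurable_surfaceMeasure hΓ)).mul
      (hDc.aestronglyMeasurable_surfaceMeasure hΓ)) (h₂ x hx)
  have hdbl : Integrable (fun y => doubleTerm n κ J x y) (surfaceMeasure Γ) :=
    integrable_of_norm_le_div_dist hΓ hx (aestronglyMeasurable_doubleTerm hΓ hn κ hFc x) (h₃ x hx)
  have hsum : ∫ y, green κ x y * ((toC3 (n x) ⬝ᵥ toC3 (n y)) * surfaceDiv Γ n (nCross n J) y +
      surfGrad Γ n (fun y => toC3 (n x) ⬝ᵥ toC3 (n y)) y ⬝ᵥ nCross n J y) ∂(surfaceMeasure Γ) =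
      (∫ y, gradTerm Γ n κ J x y ∂(surfaceMeasure Γ)) +
        ∫ y, divTerm Γ n κ J x y ∂(surfaceMeasure Γ) := by
    rw [← integral_add hgrad hdiv]
    congr 1
    ext y
    rw [gradTerm, divTerm]; ring
  refine ⟨hgrad, hdiv, hdbl, ?_, ?_⟩
  -- Principal value: the point stays at x and only the radius shrinks.
  · have h := tendsto_integral_compl_ball_curl hΓ hn κ hJ hF hFc hDc hD hx hdbl
      (l := 𝓝[>] (0 : ℝ)) (z := fun _ => x) (ε := id) tendsto_const_nhds
      (tendsto_id.mono_left nhdsWithin_le_nhds) self_mem_nhdsWithin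
      (Eventually.of_forall fun _ y _ => by linarith [dist_nonneg (x := x) (y := y)])
    rw [hsum, neg_add'] at h
    exact h
  · have hev := hn.eventually_dist_le_dist_add_smul hΓ hx
    have hdx : ∀ h : ℝ, dist (x + h • n x) x = |h| := fun h => by
      simp [norm_smul, hn.norm_eq_one x hx]
    -- If x + h n(x) were on Γ, the nontangential comparison at y = x + h n(x) would force |h| ≤ 0.
    have hpos : ∀ᶠ h : ℝ in 𝓝[≠] 0, 0 < Metric.infDist (x + h • n x) Γ := by
      filter_upwards [nhdsWithin_le_nhds hev, self_mem_nhdsWithin] with h hh h0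
      rw [← hΓ.isCompact.isClosed.notMem_iff_infDist_pos ⟨x, hx⟩]
      intro hmem
      have h1 := hh _ hmem
      rw [dist_self, mul_zero, dist_comm, hdx] at h1
      exact h0 (abs_nonpos_iff.1 h1)
    have hzl : Tendsto (fun h : ℝ => x + h • n x) (𝓝[≠] 0) (𝓝 x) := by
      have hc : Continuous fun h : ℝ => x + h • n x := by fun_prop
      simpa using (hc.tendsto 0).mono_left nhdsWithin_le_nhds
    have hεl : Tendsto (fun h : ℝ => Metric.infDist (x + h • n x) Γ) (𝓝[≠] 0) (𝓝 0) := by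
      have := ((Metric.continuous_infDist_pt Γ).tendsto x).comp hzl
      rwa [Metric.infDist_zero_of_mem hx] at this
    have h := tendsto_integral_compl_ball_curl hΓ hn κ hJ hF hFc hDc hD hx hdbl
      (l := 𝓝[≠] (0 : ℝ)) hzl hεl hpos (nhdsWithin_le_nhds hev)
    rw [hsum, neg_add'] at h
    refine h.congr' ?_
    filter_upwards [hpos] with t ht
    have hfar : ∀ y ∈ Γ, Metric.infDist (x + t • n x) Γ ≤ dist (x + t • n x) y := fun y hy =>
      Metric.infDist_le_dist_of_mem hy
    rw [dotProduct_curl_singleLayer hΓ κ hJc _ ht hfar]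
    congr 1
    -- The excised open ball has radius dist(z, Γ), so it misses Γ and the truncated integral is the
    -- full one.
    refine Measure.restrict_eq_self_of_ae_mem ?_
    filter_upwards [ae_surfaceMeasure_mem hΓ] with y hy
    simpa [dist_comm] using hfar y hy
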